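/- Let $(x,y,z)$ be a jointly Gaussian random vector in $\mathbb R^{n_x}\times\mathbb R^{n_y}\times\mathbb R^{n_z}$. For a random vector $w$, write $\Sigma_{x|w}=E\big[(x-E[x|w])(x-E[x|w])^T\big]$, so that $\Sigma_{x|z}$ and $\Sigma_{x|yz}$ are the conditional covariance matrices of $x$ given $z$ and given $(y,z)$. Let $D$ be a symmetric $n_x\times n_x$ matrix with $D\succ\Sigma_{x|yz}$. The rate-distortion function (with natural logarithms) is $$R(D)=\inf_u I(y;u\,|\,z)\quad\text{subject to}\quad E\big[(x-\hat x)(x-\hat x)^T\big]\preceq D,\qquad \hat x=E[x\,|\,u,z],$$ where the infimum is over all random vectors $u$ (of any finite dimension, defined jointly with $(x,y,z)$) such that $u\leftrightarrow y\leftrightarrow(x,z)$ is a Markov chain. Put $\Sigma_1=\Sigma_{x|z}-\Sigma_{x|yz}$ and $\Sigma_2=D-\Sigma_{x|yz}$, and let $\Sigma_1=U^T\Lambda U$ be an eigenvalue decomposition with $U$ orthogonal and $\Lambda=\mathrm{diag}(\lambda_1,\dots,\lambda_{n_x})$. Let $V$ be a nonsingular matrix with $$V\Sigma_1V^T=\Lambda,\qquad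 V\Sigma_2V^T=\Lambda'=\mathrm{diag}(\lambda'_1,\dots,\lambda'_{n_x}).$$ Let $\lambda_{(i)}$ and $\lambda'_{(i)}$ be the values $\lambda_i$ and the values $\lambda'_i$, each sorted in order of magnitude, and let $(t)^+=\max(t,1)$. Then $$\frac12\sum_{i=1}^{n_x}\log\Big(\frac{\lambda_{(i)}}{\lambda'_{(i)}}\Big)^+\;\le\;R(D)\;\le\;\frac12\sum_{i=1}^{n_x}\log\Big(\frac{\lambda_i}{\lambda'_i}\Big)^+ .$$ Moreover, write $x=Cy+Gz+c+n_2$ with $Cy+Gz+c=E[x|y,z]$. There are a matrix $W$ and a Gaussian vector $\nu$ with mean zero and nonsingular covariance matrix, independent of $(x,y,z)$, such that $u=WUCy+\nu$ is admissible (that is, it satisfies the Markov and the distortion conditions) and $I(y;u|z)$ equals the upper bound. If $\lambda'_i<\lambda_i$ for all $i$, then $u=UCy+\nu$ is admissible and $I(y;u|z)$ equals the upper bound, when $\nu$ is a Gaussian vector with mean zero, independent of $(x,y,z)$, with covariance matrix $$\Sigma_\nu=UV^{-1}\,\mathrm{diag}\Big(\frac{\lambda_i\lambda'_i}{\lambda_i-\lambda'_i}\Big)V^{-T}U^T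 .$$ -/

import Mathlib

open MeasureTheory ProbabilityTheory InformationTheory Matrix
open scoped ENNReal

noncomputable section

namespace RemoteSource

/-- Vectors in `ℝⁿ` (with the Euclidean norm). -/
abbrev Vec (n : ℕ) : Type := EuclideanSpace ℝ (Fin n)

/-- Action of a matrix on Euclidean vectors. -/
def mulVecE {m n : ℕ} (A : Matrix (Fin m) (Fin n) ℝ) (v : Vec n) : Vec m :=
  WithLp.toLp 2 (A *ᵥ v.ofLp)

lemma measurable_mulVecE {m n : ℕ} (A : Matrix (Fin m) (Fin n) ℝ) :
    Measurable (mulVecE A) := by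
  have h : Continuous (mulVecE A) := by
    unfold mulVecE
    fun_prop
  exact h.measurable

/-- The covariance matrix `E[(x - x̂)(x - x̂)ᵀ]` of the error of the best (conditional mean)
estimate `x̂ = E[x | m]` of `x` given the information `m`, computed coordinatewise. When `m` is
generated by a vector `w` which is jointly Gaussian with `x`, this is the conditional covariance
matrix `Σ_{x|w}`. -/
def errorCov {Ω : Type*} [MeasurableSpace Ω] {n : ℕ} (P : Measure Ω) (x : Ω → Vec n)
    (m : MeasurableSpace Ω) : Matrix (Fin n) (Fin n) ℝ :=
  Matrix.of fun i j =>
    ∫ ω, (x ω i - (P[fun ω' => x ω' i | m]) ω) * (x ω j - (P[fun ω' => x ω' j | m]) ω) ∂P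

/-- The conditional mutual information (in nats)
`I(Y; U | Z) = KL(P_{ZYU} ‖ P_Z ⊗ (P_{Y|Z} × P_{U|Z}))`. -/
def condMutualInfo {Ω 𝓨 𝓤 𝓩 : Type*} [MeasurableSpace Ω]
    [MeasurableSpace 𝓨] [StandardBorelSpace 𝓨] [Nonempty 𝓨]
    [MeasurableSpace 𝓤] [StandardBorelSpace 𝓤] [Nonempty 𝓤] [MeasurableSpace 𝓩]
    (P : Measure Ω) [IsFiniteMeasure P] (Y : Ω → 𝓨) (U : Ω → 𝓤) (Z : Ω → 𝓩) : ℝ≥0∞ :=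
  klDiv (P.map fun ω => (Z ω, Y ω, U ω))
    ((P.map Z) ⊗ₘ ((condDistrib Y Z P) ×ₖ (condDistrib U Z P)))

section Problem

variable {nx ny nz k : ℕ}

/-- Space of values of the triple `(x, y, z)`. -/
abbrev Src (nx ny nz : ℕ) : Type := Vec nx × Vec ny × Vec nz

/-- Space of values of the quadruple `(x, y, z, u)`. -/
abbrev Joint (nx ny nz k : ℕ) : Type := Vec nx × Vec ny × Vec nz × Vec k

/-- `Σ_{x|z}` for a triple `(x, y, z)` with law `μ`. -/
def covXgivenZ (μ : Measure (Src nx ny nz)) : Matrix (Fin nx) (Fin nx) ℝ :=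
  errorCov μ (fun w => w.1) (MeasurableSpace.comap (fun w => w.2.2) inferInstance)

/-- `Σ_{x|yz}` for a triple `(x, y, z)` with law `μ`. -/
def covXgivenYZ (μ : Measure (Src nx ny nz)) : Matrix (Fin nx) (Fin nx) ℝ :=
  errorCov μ (fun w => w.1) (MeasurableSpace.comap (fun w => w.2) inferInstance)

/-- `E[(x - x̂)(x - x̂)ᵀ]` with `x̂ = E[x | u, z]`, for a quadruple `(x, y, z, u)` with law `Q`. -/
def distortion (Q : Measure (Joint nx ny nz k)) : Matrix (Fin nx) (Fin nx) ℝ :=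
  errorCov Q (fun w => w.1)
    (MeasurableSpace.comap (fun w => (w.2.2.2, w.2.2.1)) inferInstance)

/-- The rate `I(y; u | z)` for a quadruple `(x, y, z, u)` with law `Q`. -/
def rate (Q : Measure (Joint nx ny nz k)) [IsFiniteMeasure Q] : ℝ≥0∞ :=
  condMutualInfo Q (fun w => w.2.1) (fun w => w.2.2.2) (fun w => w.2.2.1)

/-- The law `Q` of `(x, y, z, u)` is admissible for the source law `μ` and the distortion `D`:
`(x, y, z)` has law `μ`, the chain `u ↔ y ↔ (x, z)` is Markov, and
`E[(x - x̂)(x - x̂)ᵀ] ⪯ D` with `x̂ = E[x | u, z]`. -/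
structure IsAdmissible (μ : Measure (Src nx ny nz)) (D : Matrix (Fin nx) (Fin nx) ℝ)
    (Q : Measure (Joint nx ny nz k)) [IsFiniteMeasure Q] : Prop where
  law : Q.map (fun w => (w.1, w.2.1, w.2.2.1)) = μ
  markov : CondIndepFun (MeasurableSpace.comap (fun w : Joint nx ny nz k => w.2.1) inferInstance)
    (Measurable.comap_le (by fun_prop)) (fun w => w.2.2.2) (fun w => (w.1, w.2.2.1)) Q
  distortion_le : (D - distortion Q).PosSemidef

/-- The rate-distortion function `R(D)`: the infimum of `I(y; u | z)` over all random vectors `u`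
(of any dimension) with `u ↔ y ↔ (x, z)` that satisfy the distortion constraint. -/
def rdf (μ : Measure (Src nx ny nz)) (D : Matrix (Fin nx) (Fin nx) ℝ) : ℝ≥0∞ :=
  ⨅ (k : ℕ) (Q : Measure (Joint nx ny nz k)) (_ : IsProbabilityMeasure Q)
    (_ : IsAdmissible μ D Q), rate Q

/-- The law of `(x, y, z, u)` where `u = T y + ν`, `(x, y, z)` has law `μ`, and `ν` is a centred
Gaussian vector with covariance matrix `S`, independent of `(x, y, z)`. -/
def gaussianTestChannel (μ : Measure (Src nx ny nz)) (T : Matrix (Fin k) (Fin ny) ℝ)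
    (S : Matrix (Fin k) (Fin k) ℝ) : Measure (Joint nx ny nz k) :=
  (μ.prod (multivariateGaussian 0 S)).map
    (fun p => (p.1.1, p.1.2.1, p.1.2.2, mulVecE T p.1.2.1 + p.2))

instance (μ : Measure (Src nx ny nz)) [IsProbabilityMeasure μ] (T : Matrix (Fin k) (Fin ny) ℝ)
    (S : Matrix (Fin k) (Fin k) ℝ) : IsProbabilityMeasure (gaussianTestChannel μ T S) := by
  unfold gaussianTestChannel
  refine Measure.isProbabilityMeasure_map (Measurable.aemeasurable ?_)
  have h := measurable_mulVecE T
  fun_prop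

/-- `C` and `G` are coefficients of the best estimate of `x` from `y` and `z`:
`x = C y + G z + n₂` with `n₂` the estimation error, up to a constant accounting for the means. -/
def IsEstimator (μ : Measure (Src nx ny nz)) (C : Matrix (Fin nx) (Fin ny) ℝ)
    (G : Matrix (Fin nx) (Fin nz) ℝ) : Prop :=
  ∃ c : Vec nx, ∀ i : Fin nx,
    (μ[fun w => w.1 i | MeasurableSpace.comap (fun w : Src nx ny nz => w.2) inferInstance])
      =ᵐ[μ] fun w => mulVecE C w.2.1 i + mulVecE G w.2.2 i + c i

/-- Simultaneous diagonalization of `Σ₁` and `Σ₂`: `Σ₁ = Uᵀ Λ U` is an eigenvalue decomposition,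
and the nonsingular matrix `V` satisfies `V Σ₁ Vᵀ = Λ` and `V Σ₂ Vᵀ = Λ'`, where `Λ = diag l` and
`Λ' = diag l'`. -/
structure IsJointDiagonalization {n : ℕ} (Sig1 Sig2 U V : Matrix (Fin n) (Fin n) ℝ)
    (l l' : Fin n → ℝ) : Prop where
  orthogonal : U * Uᵀ = 1
  eigen : Sig1 = Uᵀ * diagonal l * U
  nonsingular : IsUnit V
  diag_left : V * Sig1 * Vᵀ = diagonal l
  diag_right : V * Sig2 * Vᵀ = diagonal l'

/-- The values of `f` sorted in increasing order. -/
def sorted {n : ℕ} (f : Fin n → ℝ) : Fin n → ℝ := f ∘ Tuple.sort f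

/-- `(1/2) ∑ᵢ log (aᵢ / bᵢ)⁺` where `(t)⁺ = max (t, 1)`. -/
def logSum {n : ℕ} (a b : Fin n → ℝ) : ℝ := (1 / 2) * ∑ i, Real.log (max (a i / b i) 1)

end Problem

end RemoteSource

end

open RemoteSource

namespace RemoteSource

section

/-! ### Order statistics: comparison of the sorted and unsorted bounds -/

section Sorting

/-! Subtract from `E[x|y,z] = C y + G z + c` the part already known from `z`, and put `w = V
(E[x|y,z] - E[x|z])`. The residual `r = x - E[x|y,z]` is independent of `(y,z)`, so `w` has
covariance `V Σ₁ Vᵀ = Λ`; moreover `w` is independent of `z` and, being Gaussian, has independent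
coordinates `N(0, lᵢ)` (`IsEstimator.exists_isInnovationForm`). The problem becomes the transmission
of a parallel Gaussian source `w`, with the distortion budget `V Σ₂ Vᵀ = Λ'`.

Converse (`IsInnovationForm.le_rate`). For admissible `u` the Markov condition keeps `r` independent
of `(y,z,u)`, so some `f(z,u)` estimates each `wᵢ` with mean square error at most `l'ᵢ`. In the
reference law of the conditional mutual information, `w` is independent of `(z,u)`. Gibbs'
inequality, tested with the density that replaces `N(0, lᵢ)` by `N(fᵢ, l'ᵢ)` on the active
coordinates `l'ᵢ < lᵢ`, yields `I(y;u|z) ≥ ½ ∑ log (lᵢ/l'ᵢ)⁺`. No entropy or density of `u` is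
needed.

Direct part (`isAdmissible_and_rate_eq_logSum`). Send the active coordinates of `V C y` with
independent noise of variance `lᵢ l'ᵢ/(lᵢ - l'ᵢ)`. Linear decoding leaves the error `l'ᵢ` on an
active coordinate and `lᵢ ≤ l'ᵢ` on an inactive one, and the rate is the same sum.

Thus `R(D)` equals the stated upper bound, and the lower bound with sorted values follows from a
rearrangement inequality (`logSum_sorted_le`). -/

lemma sorted_mono {n : ℕ} {f g : Fin n → ℝ} (h : f ≤ g) : sorted f ≤ sorted g := by
  intro i
  have hf := Tuple.monotone_sort f
  have hg := Tuple.monotone_sort g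
  -- An order statistic of index `i` is at most `t` exactly when more than `i` entries are at most
  -- `t`. Passing from `g` to the smaller `f` can only increase this count, and sorting does not
  -- change it.
  have h1 := (Tuple.lt_card_le_iff_apply_le_of_monotone (f := g ∘ Tuple.sort g) (j := i)
    (a := (g ∘ Tuple.sort g) i) hg).2 le_rfl
  refine (Tuple.lt_card_le_iff_apply_le_of_monotone (f := f ∘ Tuple.sort f) (j := i)
    (a := (g ∘ Tuple.sort g) i) hf).1 (h1.trans_le ?_)
  generalize (g ∘ Tuple.sort g) i = t
  have key : ∀ k : Fin n → ℝ, (Finset.univ.filter fun j => (k ∘ Tuple.sort k) j ≤ t).card =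
      (Finset.univ.filter fun j => k j ≤ t).card := by
    intro k
    refine Finset.card_bij (fun j _ => Tuple.sort k j) ?_ ?_ ?_
    · simp
    · simp
    · intro b hb
      exact ⟨(Tuple.sort k).symm b, by simpa using hb, by simp⟩
  rw [key f, key g]
  exact Finset.card_le_card fun j => by
    simp only [Finset.mem_filter, Finset.mem_univ, true_and]
    exact fun hj => (h j).trans hj

lemma sum_comp_sorted {n : ℕ} (f : Fin n → ℝ) (φ : ℝ → ℝ) :
    ∑ i, φ (sorted f i) = ∑ i, φ (f i) :=
  Equiv.sum_comp (Tuple.sort f) fun i => φ (f i)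

lemma log_max_div_one {a b : ℝ} (hb : 0 < b) :
    Real.log (max (a / b) 1) = Real.log (max a b) - Real.log b := by
  rw [← Real.log_div (lt_max_of_lt_right hb).ne' hb.ne', max_div_div_right hb.le a b |>.symm,
    div_self hb.ne']

/-- Each term is `log (max a b) - log b`, and the sum of the `log b` ignores order. Both sorted
sequences lie below the sorted sequence of the maxima, so sorting can only decrease the first part.
-/
lemma logSum_sorted_le {n : ℕ} (a b : Fin n → ℝ) (hb : ∀ i, 0 < b i) :
    logSum (sorted a) (sorted b) ≤ logSum a b := by
  unfold logSum
  have hsb : ∀ i, 0 < sorted b i := fun i => hb _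
  simp_rw [log_max_div_one (hb _), log_max_div_one (hsb _), Finset.sum_sub_distrib]
  rw [sum_comp_sorted b Real.log]
  have h : ∑ i, Real.log (max (sorted a i) (sorted b i)) ≤ ∑ i, Real.log (max (a i) (b i)) := by
    rw [← sum_comp_sorted (fun i => max (a i) (b i)) Real.log]
    refine Finset.sum_le_sum fun i _ => Real.log_le_log (lt_max_of_lt_right (hsb i)) (max_le ?_ ?_)
    · exact sorted_mono (fun j => le_max_left _ _) i
    · exact sorted_mono (fun j => le_max_right _ _) i
  linarith

end Sorting

/-! ### Lower bound and exact value of the Kullback-Leibler divergence -/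

section Divergence

variable {α : Type*} [MeasurableSpace α]

/-- Gibbs' variational inequality for the Kullback-Leibler divergence. -/
lemma ofReal_integral_le_klDiv (P ν : Measure α) [IsProbabilityMeasure P] [IsProbabilityMeasure ν]
    {g : α → ℝ} (hg : Measurable g) (hgP : Integrable g P)
    (hν : ∫⁻ x, ENNReal.ofReal (Real.exp (g x)) ∂ν = 1) :
    ENNReal.ofReal (∫ x, g x ∂P) ≤ klDiv P ν := by
  by_cases h : P ≪ ν
  swap; · simp [h]
  by_cases hint : Integrable (llr P ν) P
  swap; · simp [klDiv_of_not_integrable hint]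
  have hexp : Integrable (fun x => Real.exp (g x)) ν := by
    refine ⟨(Real.measurable_exp.comp hg).aestronglyMeasurable, ?_⟩
    rw [hasFiniteIntegral_iff_ofReal (ae_of_all _ fun x => (Real.exp_pos _).le), hν]
    exact ENNReal.one_lt_top
  have hexp1 : ∫ x, Real.exp (g x) ∂ν = 1 := by
    rw [integral_eq_lintegral_of_nonneg_ae (ae_of_all _ fun x => (Real.exp_pos _).le)
      hexp.aestronglyMeasurable, hν, ENNReal.toReal_one]
  -- As `exp g` has `ν`-integral one, tilting gives a probability measure with log-density `g`. The
  -- claim is the nonnegativity of the divergence of `P` from it, which is `KL(P‖ν) - ∫ g dP`.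
  have hac : P ≪ ν.tilted g := h.trans (absolutelyContinuous_tilted hexp)
  have : IsProbabilityMeasure (ν.tilted g) := isProbabilityMeasure_tilted hexp
  have h0 := integral_llr_add_sub_measure_univ_nonneg hac
    (integrable_llr_tilted_right h hgP hint hexp)
  rw [integral_llr_tilted_right h hgP hexp hint, hexp1] at h0
  rw [klDiv_of_ac_of_integrable h hint]
  refine ENNReal.ofReal_le_ofReal ?_
  simp at h0 ⊢
  linarith

/-- The equality case of the preceding inequality: the log-likelihood ratio is `g` itself. -/
lemma klDiv_withDensity_exp (ν : Measure α) [IsProbabilityMeasure ν] {g : α → ℝ}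
    (hg : Measurable g)
    [IsProbabilityMeasure (ν.withDensity fun x => ENNReal.ofReal (Real.exp (g x)))]
    (hint : Integrable g (ν.withDensity fun x => ENNReal.ofReal (Real.exp (g x)))) :
    klDiv (ν.withDensity fun x => ENNReal.ofReal (Real.exp (g x))) ν =
      ENNReal.ofReal (∫ x, g x ∂(ν.withDensity fun x => ENNReal.ofReal (Real.exp (g x)))) := by
  have hmeas : Measurable fun x => ENNReal.ofReal (Real.exp (g x)) := by fun_prop
  have hac := withDensity_absolutelyContinuous ν fun x => ENNReal.ofReal (Real.exp (g x))
  have hllr : llr (ν.withDensity fun x => ENNReal.ofReal (Real.exp (g x))) ν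
      =ᵐ[ν.withDensity fun x => ENNReal.ofReal (Real.exp (g x))] g := by
    filter_upwards [hac.ae_le (Measure.rnDeriv_withDensity ν hmeas)] with x hx
    simp [llr, hx, ENNReal.toReal_ofReal (Real.exp_pos _).le]
  rw [klDiv_of_ac_of_integrable hac (hint.congr hllr.symm), integral_congr_ae hllr]
  simp

end Divergence

/-! ### Gaussian likelihood ratios and densities on product spaces -/

section GaussianDensity

/-- Logarithm of the density of the normal law with mean `c` and variance `v'` with respect to the
centred normal law with variance `v`. -/
@[irreducible] noncomputable def gaussianLogRatio (v v' c t : ℝ) : ℝ :=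
  1 / 2 * Real.log (v / v') - (t - c) ^ 2 / (2 * v') + t ^ 2 / (2 * v)

lemma measurable_gaussianLogRatio (v v' : ℝ) :
    Measurable fun p : ℝ × ℝ => gaussianLogRatio v v' p.1 p.2 := by
  unfold gaussianLogRatio
  fun_prop

lemma gaussianPDFReal_mul_exp_logRatio {v v' : ℝ} (hv : 0 < v) (hv' : 0 < v') (c t : ℝ) :
    gaussianPDFReal 0 v.toNNReal t * Real.exp (gaussianLogRatio v v' c t) =
      gaussianPDFReal c v'.toNNReal t := by
  have hs : Real.exp (1 / 2 * Real.log (v / v')) = √(2 * Real.pi * v) / √(2 * Real.pi * v') := by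
    rw [← Real.sqrt_div (by positivity), mul_div_mul_left _ _ (by positivity),
      Real.sqrt_eq_rpow, Real.rpow_def_of_pos (by positivity), mul_comm]
  have hsq : √(2 * Real.pi * v) ≠ 0 := by positivity
  simp only [gaussianPDFReal, gaussianLogRatio, Real.coe_toNNReal _ hv.le,
    Real.coe_toNNReal _ hv'.le]
  rw [show 1 / 2 * Real.log (v / v') - (t - c) ^ 2 / (2 * v') + t ^ 2 / (2 * v) =
    1 / 2 * Real.log (v / v') + -(t - c) ^ 2 / (2 * v') + t ^ 2 / (2 * v) by ring,
    Real.exp_add, Real.exp_add, hs, sub_zero,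
    show -t ^ 2 / (2 * v) = -(t ^ 2 / (2 * v)) by ring, Real.exp_neg]
  have := (Real.exp_pos (t ^ 2 / (2 * v))).ne'
  field_simp

lemma withDensity_gaussianLogRatio {v v' : ℝ} (hv : 0 < v) (hv' : 0 < v') (c : ℝ) :
    (gaussianReal 0 v.toNNReal).withDensity
        (fun t => ENNReal.ofReal (Real.exp (gaussianLogRatio v v' c t))) =
      gaussianReal c v'.toNNReal := by
  have h := (measurable_gaussianLogRatio v v').comp (measurable_prodMk_left (x := c))
  have hm : Measurable fun t => gaussianLogRatio v v' c t := h
  rw [gaussianReal_of_var_ne_zero _ (by simpa using hv),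
    gaussianReal_of_var_ne_zero _ (by simpa using hv'),
    ← withDensity_mul _ (measurable_gaussianPDF _ _) (by fun_prop)]
  congr 1
  ext t
  rw [Pi.mul_apply, gaussianPDF, gaussianPDF, ← ENNReal.ofReal_mul (gaussianPDFReal_nonneg _ _ _),
    gaussianPDFReal_mul_exp_logRatio hv hv']

lemma lintegral_pi_prod {ι : Type*} [Fintype ι] {X : ι → Type*} [∀ i, MeasurableSpace (X i)]
    (μ : ∀ i, Measure (X i)) [∀ i, IsProbabilityMeasure (μ i)] {f : ∀ i, X i → ℝ≥0∞}
    (hf : ∀ i, Measurable (f i)) :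
    ∫⁻ x, ∏ i, f i (x i) ∂(Measure.pi μ) = ∏ i, ∫⁻ t, f i t ∂(μ i) := by
  rw [lintegral_prod_eq_prod_lintegral_of_indepFun Finset.univ (fun i (x : ∀ i, X i) => f i (x i))
    (iIndepFun_pi fun i => (hf i).aemeasurable) (fun i => (hf i).comp (measurable_pi_apply i))]
  refine Finset.prod_congr rfl fun i _ => ?_
  rw [← (measurePreserving_eval μ i).lintegral_comp (hf i)]

lemma pi_withDensity {ι : Type*} [Fintype ι] {X : ι → Type*} [∀ i, MeasurableSpace (X i)]
    (μ ν : ∀ i, Measure (X i)) [∀ i, IsProbabilityMeasure (μ i)] [∀ i, IsProbabilityMeasure (ν i)]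
    {f : ∀ i, X i → ℝ≥0∞} (hf : ∀ i, Measurable (f i)) (h : ∀ i, (μ i).withDensity (f i) = ν i) :
    (Measure.pi μ).withDensity (fun x => ∏ i, f i (x i)) = Measure.pi ν := by
  symm
  refine Measure.pi_eq fun s hs => ?_
  rw [withDensity_apply _ (MeasurableSet.univ_pi hs), ← lintegral_indicator
    (MeasurableSet.univ_pi hs)]
  have : ((Set.univ.pi s).indicator fun x => ∏ i, f i (x i)) =
      fun x => ∏ i, (s i).indicator (f i) (x i) := by
    classical
    ext x
    simp only [Set.indicator_apply, Set.mem_univ_pi]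
    split_ifs with hx
    · exact Finset.prod_congr rfl fun i _ => by rw [if_pos (hx i)]
    · push Not at hx
      obtain ⟨i, hi⟩ := hx
      exact (Finset.prod_eq_zero (Finset.mem_univ i) (if_neg hi)).symm
  rw [this, lintegral_pi_prod _ fun i => (hf i).indicator (hs i)]
  refine Finset.prod_congr rfl fun i _ => ?_
  rw [← h i, withDensity_apply _ (hs i), lintegral_indicator (hs i)]

end GaussianDensity

end

section

/-! ### Statistics independent of `z` under conditional product laws -/

section Kernels

variable {𝓐 𝓑 𝓦 𝓩 : Type*} [MeasurableSpace 𝓐] [MeasurableSpace 𝓑]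
  [MeasurableSpace 𝓦] [MeasurableSpace.CountablyGenerated 𝓦] [MeasurableSpace 𝓩]

/-- Both sides disintegrate over `m`, and kernels into a countably generated space with the same
composition product agree almost everywhere. -/
lemma ae_map_eq_of_compProd_map_eq_prod (m : Measure 𝓩) [IsFiniteMeasure m] (κ : Kernel 𝓩 𝓐)
    [IsMarkovKernel κ] (N : Measure 𝓦) [IsProbabilityMeasure N] {φ : 𝓩 × 𝓐 → 𝓦} (hφ : Measurable φ)
    (h : (m ⊗ₘ κ).map (fun p => (p.1, φ p)) = m.prod N) :
    ∀ᵐ z ∂m, (κ z).map (fun a => φ (z, a)) = N := by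
  have hm : Measurable fun p : 𝓩 × 𝓐 => φ p := hφ
  have key : m ⊗ₘ ((Kernel.id ×ₖ κ).map φ) = m ⊗ₘ Kernel.const 𝓩 N := by
    have := Kernel.IsMarkovKernel.map (Kernel.id ×ₖ κ) hφ
    rw [Measure.compProd_const, ← h]
    refine Measure.ext_of_lintegral _ fun f hf => ?_
    rw [lintegral_map hf (by fun_prop), Measure.lintegral_compProd hf,
      Measure.lintegral_compProd (by fun_prop)]
    refine lintegral_congr fun z => ?_
    rw [Kernel.lintegral_map _ hφ _ (by fun_prop), Kernel.lintegral_prod _ _ _ (by fun_prop),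
      Kernel.id_apply, lintegral_dirac']
    refine Measurable.lintegral_kernel_prod_right' (κ := Kernel.const 𝓩 (κ z))
      (f := fun p : 𝓩 × 𝓐 => f (z, φ p)) (by fun_prop)
  have := Kernel.IsMarkovKernel.map (Kernel.id ×ₖ κ) hφ
  filter_upwards [Kernel.ae_eq_of_compProd_eq key] with z hz
  rw [Kernel.map_apply _ hφ, Kernel.const_apply, Kernel.prod_apply, Kernel.id_apply,
    Measure.dirac_prod, Measure.map_map hφ (by fun_prop)] at hz
  exact hz

/-- Under `κ ×ₖ η` the two components are conditionally independent given `z`. A statistic of the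
first whose conditional law does not depend on `z` is therefore independent of `z` together with the
second. This version serves statistics of `y` in the converse; the mirrored one below serves
statistics of `u`. -/
lemma map_compProd_prod_eq_prod_left (m : Measure 𝓩) [IsFiniteMeasure m] (κ : Kernel 𝓩 𝓐)
    [IsMarkovKernel κ] (η : Kernel 𝓩 𝓑) [IsMarkovKernel η] (N : Measure 𝓦) [IsProbabilityMeasure N]
    {φ : 𝓩 × 𝓐 → 𝓦} (hφ : Measurable φ)
    (h : (m ⊗ₘ κ).map (fun p => (p.1, φ p)) = m.prod N) :
    (m ⊗ₘ (κ ×ₖ η)).map (fun p => ((p.1, p.2.2), φ (p.1, p.2.1))) = (m ⊗ₘ η).prod N := by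
  refine Measure.ext_of_lintegral _ fun f hf => ?_
  have hF : Measurable fun q : 𝓩 × 𝓑 => ∫⁻ w, f (q, w) ∂N := hf.lintegral_prod_right'
  rw [lintegral_map hf (by fun_prop), Measure.lintegral_compProd (by fun_prop),
    lintegral_prod _ hf.aemeasurable, Measure.lintegral_compProd hF]
  refine lintegral_congr_ae ?_
  filter_upwards [ae_map_eq_of_compProd_map_eq_prod m κ N hφ h] with z hz
  rw [Kernel.prod_apply, lintegral_prod_symm _ (by fun_prop)]
  refine lintegral_congr fun b => ?_
  rw [← hz, lintegral_map (by fun_prop) (by fun_prop)]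

lemma map_compProd_prod_eq_prod_right (m : Measure 𝓩) [IsFiniteMeasure m] (κ : Kernel 𝓩 𝓐)
    [IsMarkovKernel κ] (η : Kernel 𝓩 𝓑) [IsMarkovKernel η] (N : Measure 𝓦) [IsProbabilityMeasure N]
    {φ : 𝓩 × 𝓐 → 𝓦} (hφ : Measurable φ)
    (h : (m ⊗ₘ κ).map (fun p => (p.1, φ p)) = m.prod N) :
    (m ⊗ₘ (η ×ₖ κ)).map (fun p => ((p.1, p.2.1), φ (p.1, p.2.2))) = (m ⊗ₘ η).prod N := by
  refine Measure.ext_of_lintegral _ fun f hf => ?_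
  have hF : Measurable fun q : 𝓩 × 𝓑 => ∫⁻ w, f (q, w) ∂N := hf.lintegral_prod_right'
  rw [lintegral_map hf (by fun_prop), Measure.lintegral_compProd (by fun_prop),
    lintegral_prod _ hf.aemeasurable, Measure.lintegral_compProd hF]
  refine lintegral_congr_ae ?_
  filter_upwards [ae_map_eq_of_compProd_map_eq_prod m κ N hφ h] with z hz
  rw [Kernel.prod_apply, lintegral_prod _ (by fun_prop)]
  refine lintegral_congr fun b => ?_
  rw [← hz, lintegral_map (by fun_prop) (by fun_prop)]

end Kernels

/-! ### The Markov condition as a channel from `y` to `u` -/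

section Channel

variable {nx ny nz k : ℕ}

lemma lintegral_of_law {μ : Measure (Src nx ny nz)} {Q : Measure (Joint nx ny nz k)}
    (hlaw : Q.map (fun w => (w.1, w.2.1, w.2.2.1)) = μ) {G : Src nx ny nz → ℝ≥0∞}
    (hG : Measurable G) : ∫⁻ w, G (w.1, w.2.1, w.2.2.1) ∂Q = ∫⁻ s, G s ∂μ := by
  rw [← hlaw, lintegral_map hG (by fun_prop)]

/-- `Q` is the law of the source `μ` together with the output of the channel `κ` fed with `y`. -/
def IsChannelLaw (μ : Measure (Src nx ny nz)) (κ : Kernel (Vec ny) (Vec k))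
    (Q : Measure (Joint nx ny nz k)) : Prop :=
  ∀ F : Joint nx ny nz k → ℝ≥0∞, Measurable F →
    ∫⁻ w, F w ∂Q = ∫⁻ s, ∫⁻ u, F (s.1, s.2.1, s.2.2, u) ∂(κ s.2.1) ∂μ

lemma measurable_lintegral_channel (κ : Kernel (Vec ny) (Vec k)) [IsMarkovKernel κ]
    {F : Joint nx ny nz k → ℝ≥0∞} (hF : Measurable F) :
    Measurable fun s : Src nx ny nz => ∫⁻ u, F (s.1, s.2.1, s.2.2, u) ∂(κ s.2.1) :=
  Measurable.lintegral_kernel_prod_right' (κ := κ.comap (fun s : Src nx ny nz => s.2.1)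
    (by fun_prop)) (f := fun p : Src nx ny nz × Vec k => F (p.1.1, p.1.2.1, p.1.2.2, p.2))
    (by fun_prop)

/-- The Markov chain says that the conditional law of `u` given `(y,x,z)` depends on `y` only, so
the conditional law of `u` given `y` serves as the channel. -/
lemma exists_isChannelLaw {μ : Measure (Src nx ny nz)} {Q : Measure (Joint nx ny nz k)}
    [IsProbabilityMeasure Q] (hlaw : Q.map (fun w => (w.1, w.2.1, w.2.2.1)) = μ)
    (hmarkov : CondIndepFun
      (MeasurableSpace.comap (fun w : Joint nx ny nz k => w.2.1) inferInstance)
      (Measurable.comap_le (by fun_prop)) (fun w => w.2.2.2) (fun w => (w.1, w.2.2.1)) Q) :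
    ∃ κ : Kernel (Vec ny) (Vec k), IsMarkovKernel κ ∧ IsChannelLaw μ κ Q := by
  refine ⟨condDistrib (fun w : Joint nx ny nz k => w.2.2.2) (fun w => w.2.1) Q, inferInstance,
    fun F hF => ?_⟩
  have h := (condIndepFun_iff_condDistrib_prod_ae_eq_prodMkRight (μ := Q)
    (f := fun w : Joint nx ny nz k => w.2.2.2) (g := fun w => (w.1, w.2.2.1)) (k := fun w => w.2.1)
    (by fun_prop) (by fun_prop) (by fun_prop)).1 hmarkov.symm
  rw [condDistrib_ae_eq_iff_measure_eq_compProd _ (by fun_prop)] at h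
  have hF' : Measurable fun p : (Vec ny × Vec nx × Vec nz) × Vec k =>
      F (p.1.2.1, p.1.1, p.1.2.2, p.2) := by fun_prop
  have h2 : ∫⁻ w, F w ∂Q = ∫⁻ p : (Vec ny × Vec nx × Vec nz) × Vec k,
      F (p.1.2.1, p.1.1, p.1.2.2, p.2) ∂(Q.map fun w => ((w.2.1, w.1, w.2.2.1), w.2.2.2)) :=
    (lintegral_map (g := fun w : Joint nx ny nz k => ((w.2.1, w.1, w.2.2.1), w.2.2.2)) hF'
      (by fun_prop)).symm
  rw [h2, h, Measure.lintegral_compProd hF',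
    lintegral_map hF'.lintegral_kernel_prod_right' (by fun_prop),
    ← lintegral_of_law hlaw (measurable_lintegral_channel _ hF)]
  rfl

lemma IsChannelLaw.law {μ : Measure (Src nx ny nz)} {Q : Measure (Joint nx ny nz k)}
    {κ : Kernel (Vec ny) (Vec k)} [IsMarkovKernel κ] (h : IsChannelLaw μ κ Q) :
    Q.map (fun w => (w.1, w.2.1, w.2.2.1)) = μ := by
  refine Measure.ext_of_lintegral _ fun f hf => ?_
  rw [lintegral_map hf (by fun_prop), h _ (by fun_prop)]
  simp

lemma IsChannelLaw.condIndepFun {μ : Measure (Src nx ny nz)} {Q : Measure (Joint nx ny nz k)}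
    [IsProbabilityMeasure Q] {κ : Kernel (Vec ny) (Vec k)} [IsMarkovKernel κ]
    (h : IsChannelLaw μ κ Q) :
    CondIndepFun (MeasurableSpace.comap (fun w : Joint nx ny nz k => w.2.1) inferInstance)
      (Measurable.comap_le (by fun_prop)) (fun w => w.2.2.2) (fun w => (w.1, w.2.2.1)) Q := by
  refine CondIndepFun.symm ?_
  refine (condIndepFun_iff_condDistrib_prod_ae_eq_prodMkRight (μ := Q)
    (f := fun w : Joint nx ny nz k => w.2.2.2) (g := fun w => (w.1, w.2.2.1)) (k := fun w => w.2.1)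
    (by fun_prop) (by fun_prop) (by fun_prop)).2 ?_
  have h1 : condDistrib (fun w : Joint nx ny nz k => w.2.2.2)
      (fun w => (w.2.1, (w.1, w.2.2.1))) Q =ᵐ[Q.map (fun w => (w.2.1, (w.1, w.2.2.1)))]
      κ.prodMkRight _ := by
    rw [condDistrib_ae_eq_iff_measure_eq_compProd _ (by fun_prop)]
    refine Measure.ext_of_lintegral _ fun f hf => ?_
    rw [lintegral_map hf (by fun_prop), h _ (by fun_prop), Measure.lintegral_compProd hf,
      lintegral_map (Measurable.lintegral_kernel_prod_right' hf) (by fun_prop)]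
    exact (lintegral_of_law h.law (measurable_lintegral_channel κ
      (F := fun w : Joint nx ny nz k => f ((w.2.1, (w.1, w.2.2.1)), w.2.2.2)) (by fun_prop))).symm
  have h2 : condDistrib (fun w : Joint nx ny nz k => w.2.2.2) (fun w => w.2.1) Q
      =ᵐ[Q.map (fun w => w.2.1)] κ := by
    rw [condDistrib_ae_eq_iff_measure_eq_compProd _ (by fun_prop)]
    refine Measure.ext_of_lintegral _ fun f hf => ?_
    rw [lintegral_map hf (by fun_prop), h _ (by fun_prop), Measure.lintegral_compProd hf,
      lintegral_map (Measurable.lintegral_kernel_prod_right' hf) (by fun_prop)]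
    exact (lintegral_of_law h.law (measurable_lintegral_channel κ
      (F := fun w : Joint nx ny nz k => f (w.2.1, w.2.2.2)) (by fun_prop))).symm
  have h3 : (Q.map (fun w => (w.2.1, (w.1, w.2.2.1)))).map Prod.fst = Q.map (fun w => w.2.1) := by
    rw [Measure.map_map (by fun_prop) (by fun_prop)]
    rfl
  rw [← h3] at h2
  filter_upwards [h1, ae_of_ae_map (by fun_prop) h2] with p hp1 hp2
  rw [hp1, Kernel.prodMkRight_apply, Kernel.prodMkRight_apply, ← hp2]

/-- A function of the source which is independent of `(y, z)` is independent of `(y, z, u)`. -/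
lemma IsChannelLaw.indepFun {μ : Measure (Src nx ny nz)} {Q : Measure (Joint nx ny nz k)}
    [IsProbabilityMeasure Q] [IsProbabilityMeasure μ] {κ : Kernel (Vec ny) (Vec k)}
    [IsMarkovKernel κ] (h : IsChannelLaw μ κ Q) {E : Type*} [MeasurableSpace E]
    {ρ : Src nx ny nz → E} (hρ : Measurable ρ) (hind : IndepFun ρ (fun s => s.2) μ) :
    IndepFun (fun w : Joint nx ny nz k => ρ (w.1, w.2.1, w.2.2.1)) (fun w => w.2) Q := by
  rw [indepFun_iff_map_prod_eq_prod_map_map (by fun_prop) (by fun_prop)] at hind ⊢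
  refine Measure.ext_of_lintegral _ fun f hf => ?_
  have hF : Measurable fun p : E × (Vec ny × Vec nz) =>
      ∫⁻ u, f (p.1, p.2.1, p.2.2, u) ∂(κ p.2.1) :=
    Measurable.lintegral_kernel_prod_right' (κ := κ.comap (fun p : E × (Vec ny × Vec nz) => p.2.1)
      (by fun_prop)) (f := fun q : (E × (Vec ny × Vec nz)) × Vec k =>
        f (q.1.1, q.1.2.1, q.1.2.2, q.2)) (by fun_prop)
  have hleft : ∫⁻ w, f (ρ (w.1, w.2.1, w.2.2.1), w.2) ∂Q =
      ∫⁻ p, ∫⁻ u, f (p.1, p.2.1, p.2.2, u) ∂(κ p.2.1) ∂(μ.map fun s => (ρ s, s.2)) := by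
    rw [h _ (by fun_prop), lintegral_map hF (by fun_prop)]
  rw [lintegral_map hf (by fun_prop), hleft, hind, lintegral_prod _ hF.aemeasurable,
    lintegral_prod _ hf.aemeasurable, lintegral_map hF.lintegral_prod_right' hρ,
    lintegral_map hf.lintegral_prod_right' (by fun_prop)]
  have hG : Measurable fun e : E => ∫⁻ y, f (e, y) ∂(Q.map fun w => w.2) :=
    hf.lintegral_prod_right'
  refine Eq.trans ?_ (lintegral_of_law h.law (hG.comp hρ)).symm
  refine lintegral_congr fun s => ?_
  simp only [Function.comp_apply]
  have hFs : Measurable fun y : Vec ny × Vec nz => ∫⁻ u, f (ρ s, y.1, y.2, u) ∂(κ y.1) :=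
    hF.comp measurable_prodMk_left
  rw [lintegral_map hFs (by fun_prop), lintegral_map (by fun_prop) (by fun_prop), h _ (by fun_prop)]

end Channel

end

section

/-! ### Linear regression and independence for Gaussian vectors -/

section Regression

variable {Ω : Type*} [MeasurableSpace Ω] {P : Measure Ω} [IsProbabilityMeasure P]

lemma inner_toLp_sub_integral {X Y : Ω → ℝ} (hX : MemLp X 2 P) (hY : MemLp Y 2 P) :
    inner ℝ ((hX.sub (memLp_const P[X])).toLp _) ((hY.sub (memLp_const P[Y])).toLp _) =
      cov[X, Y; P] := by
  rw [L2.inner_def, covariance]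
  refine integral_congr_ae ?_
  filter_upwards [(hX.sub (memLp_const P[X])).coeFn_toLp, (hY.sub (memLp_const P[Y])).coeFn_toLp]
    with ω h1 h2
  rw [h1, h2]
  simp [mul_comm]

/-- The coefficients come from the orthogonal projection in `L²` of the centred `X` onto the span of
the centred `T k`. The covariance matrix of the `T k` may thus be singular. -/
lemma exists_covariance_sub_sum_eq_zero {κ : Type*} [Fintype κ] {X : Ω → ℝ} (hX : MemLp X 2 P)
    {T : κ → Ω → ℝ} (hT : ∀ k, MemLp (T k) 2 P) :
    ∃ c : κ → ℝ, ∀ j, cov[fun ω => X ω - ∑ k, c k * T k ω, T j; P] = 0 := by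
  let x := (hX.sub (memLp_const P[X])).toLp _
  let t : κ → Lp ℝ 2 P := fun k => ((hT k).sub (memLp_const P[T k])).toLp _
  let K := Submodule.span ℝ (Set.range t)
  have : FiniteDimensional ℝ K := FiniteDimensional.span_of_finite ℝ (Set.finite_range t)
  have hmem : K.starProjection x ∈ K := K.starProjection_apply_mem x
  obtain ⟨c, hc⟩ := (Submodule.mem_span_range_iff_exists_fun ℝ).1 hmem
  refine ⟨c, fun j => ?_⟩
  have horth : inner ℝ (t j) (x - K.starProjection x) = 0 :=
    K.sub_starProjection_mem_orthogonal x _ (Submodule.subset_span ⟨j, rfl⟩)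
  rw [← hc, inner_sub_right, inner_sum] at horth
  simp_rw [inner_smul_right] at horth
  have h1 : inner ℝ (t j) x = cov[T j, X; P] := inner_toLp_sub_integral (hT j) hX
  have h2 : ∀ k, inner ℝ (t j) (t k) = cov[T j, T k; P] :=
    fun k => inner_toLp_sub_integral (hT j) (hT k)
  simp_rw [h1, h2] at horth
  rw [covariance_fun_sub_left hX (memLp_finsetSum _ fun k _ => (hT k).const_mul _) (hT j),
    covariance_fun_sum_left (fun k => (hT k).const_mul _) (hT j)]
  simp_rw [covariance_const_mul_left]
  rw [covariance_comm, ← horth]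
  congr 1
  exact Finset.sum_congr rfl fun k _ => by rw [covariance_comm]

lemma condExp_add_comp_of_indepFun {F : Type*} [MeasurableSpace F] {e : Ω → ℝ} {T : Ω → F}
    {b : F → ℝ} (hem : Measurable e) (he : Integrable e P) (hT : Measurable T) (hb : Measurable b)
    (hbT : Integrable (fun ω => b (T ω)) P) (hind : IndepFun e T P) (h0 : ∫ ω, e ω ∂P = 0) :
    P[fun ω => e ω + b (T ω) | MeasurableSpace.comap T inferInstance] =ᵐ[P] fun ω => b (T ω) := by
  have h1 : P[e | MeasurableSpace.comap T inferInstance] =ᵐ[P] fun _ => P[e] :=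
    condExp_indep_eq hem.comap_le hT.comap_le (comap_measurable e).stronglyMeasurable hind
  have h2 : P[fun ω => b (T ω) | MeasurableSpace.comap T inferInstance] = fun ω => b (T ω) :=
    condExp_of_stronglyMeasurable hT.comap_le
      (hb.comp (comap_measurable T)).stronglyMeasurable hbT
  refine (condExp_add he hbT _).trans ?_
  rw [h2]
  filter_upwards [h1] with ω hω
  rw [Pi.add_apply, hω, h0, zero_add]

end Regression

section Gaussian

variable {E : Type*} [NormedAddCommGroup E] [NormedSpace ℝ E] [FiniteDimensional ℝ E]
  [MeasurableSpace E] [BorelSpace E] {μ : Measure E} [IsGaussian μ]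

lemma hasGaussianLaw_linearMap {F : Type*} [NormedAddCommGroup F] [NormedSpace ℝ F]
    [MeasurableSpace F] [BorelSpace F] (L : E →ₗ[ℝ] F) : HasGaussianLaw (fun s => L s) μ :=
  IsGaussian.hasGaussianLaw_id.map_fun L.toContinuousLinearMap

lemma memLp_linearMap (L : E →ₗ[ℝ] ℝ) : MemLp (fun s => L s) 2 μ :=
  (hasGaussianLaw_linearMap L).memLp_two

lemma indepFun_linearMap {ι κ : Type*} [Fintype ι] [Fintype κ] (X : ι → E →ₗ[ℝ] ℝ)
    (Y : κ → E →ₗ[ℝ] ℝ) (h : ∀ i j, cov[fun s => X i s, fun s => Y j s; μ] = 0) :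
    IndepFun (fun s i => X i s) (fun s j => Y j s) μ :=
  (hasGaussianLaw_linearMap ((LinearMap.pi X).prod (LinearMap.pi Y))).indepFun_of_covariance_eval h

/-- Joint Gaussianity upgrades the `L²` orthogonality of the regression error to independence. -/
lemma exists_indepFun_regression {ι κ : Type*} [Fintype ι] [Fintype κ] (X : ι → E →ₗ[ℝ] ℝ)
    (T : κ → E →ₗ[ℝ] ℝ) : ∃ A : Matrix ι κ ℝ,
      IndepFun (fun s i => X i s - ∑ k, A i k * T k s) (fun s j => T j s) μ := by
  choose A hA using fun i => exists_covariance_sub_sum_eq_zero (P := μ) (memLp_linearMap (X i))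
    (fun k => memLp_linearMap (T k))
  refine ⟨A, ?_⟩
  have := indepFun_linearMap (μ := μ) (fun i => X i - ∑ k, A i k • T k) T
    (fun i j => by simpa using hA i j)
  simpa using this

lemma map_linearMap_sub_const_eq_pi {ι : Type*} [Fintype ι] (X : ι → E →ₗ[ℝ] ℝ) (m : ι → ℝ)
    (hm : ∀ i, ∫ s, (X i s - m i) ∂μ = 0)
    (h : ∀ i j, i ≠ j → cov[fun s => X i s, fun s => X j s; μ] = 0) :
    μ.map (fun s i => X i s - m i) =
      Measure.pi fun i => gaussianReal 0 (Var[fun s => X i s; μ]).toNNReal := by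
  have hind : iIndepFun (fun i s => X i s) μ :=
    (hasGaussianLaw_linearMap (LinearMap.pi X)).iIndepFun_of_covariance_eq_zero h
  have hmeas : ∀ i, Measurable fun s => X i s :=
    fun i => (X i).toContinuousLinearMap.continuous.measurable
  have hind2 : iIndepFun (fun i s => X i s - m i) μ :=
    hind.comp (fun i t => t - m i) fun i => by fun_prop
  rw [(iIndepFun_iff_map_fun_eq_pi_map fun i => ((hmeas i).sub_const _).aemeasurable).1 hind2]
  congr 1
  ext1 i
  have h1 : ∫ s, X i s ∂μ = m i := by
    have := hm i
    rw [integral_sub ((memLp_linearMap (X i)).integrable one_le_two) (integrable_const _)] at this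
    simpa [sub_eq_zero] using this
  have h2 : μ.map (fun s => X i s - m i) = (μ.map fun s => X i s).map (fun t => t - m i) := by
    rw [Measure.map_map (by fun_prop) (hmeas i)]
    rfl
  rw [h2, (hasGaussianLaw_linearMap (X i)).map_eq_gaussianReal, gaussianReal_map_sub_const, h1,
    sub_self]

end Gaussian

end

section

/-! ### The estimate of `x` from `(y,z)` and its residual -/

variable {nx ny nz : ℕ}

/-- The affine estimate `C y + G z + c`. -/
def estimate (C : Matrix (Fin nx) (Fin ny) ℝ) (G : Matrix (Fin nx) (Fin nz) ℝ) (c : Vec nx)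
    (p : Vec ny × Vec nz) : Fin nx → ℝ :=
  C *ᵥ p.1.ofLp + G *ᵥ p.2.ofLp + c.ofLp

/-- The error of the estimate `C y + G z + c` of `x`. -/
def residual (C : Matrix (Fin nx) (Fin ny) ℝ) (G : Matrix (Fin nx) (Fin nz) ℝ) (c : Vec nx)
    (s : Src nx ny nz) : Fin nx → ℝ :=
  s.1.ofLp - estimate C G c s.2

/-- The difference of `V C y` and the function `a` of `z`. -/
@[irreducible] def innovation (V : Matrix (Fin nx) (Fin nx) ℝ) (C : Matrix (Fin nx) (Fin ny) ℝ)
    (a : Vec nz → Fin nx → ℝ) (p : Vec ny × Vec nz) : Fin nx → ℝ :=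
  V *ᵥ (C *ᵥ p.1.ofLp) - a p.2

@[fun_prop]
lemma measurable_mulVec_ofLp {m n : ℕ} (A : Matrix (Fin m) (Fin n) ℝ) :
    Measurable fun v : Vec n => A *ᵥ v.ofLp := by
  have h : Continuous fun v : Vec n => A *ᵥ v.ofLp := by fun_prop
  exact h.measurable

@[fun_prop]
lemma measurable_mulVec {m n : ℕ} (A : Matrix (Fin m) (Fin n) ℝ) :
    Measurable fun v : Fin n → ℝ => A *ᵥ v := by
  have h : Continuous fun v : Fin n → ℝ => A *ᵥ v := by fun_prop
  exact h.measurable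

@[fun_prop]
lemma measurable_estimate (C : Matrix (Fin nx) (Fin ny) ℝ) (G : Matrix (Fin nx) (Fin nz) ℝ)
    (c : Vec nx) : Measurable (estimate C G c) := by
  unfold estimate
  exact ((measurable_mulVec_ofLp C).comp measurable_fst).add
    ((measurable_mulVec_ofLp G).comp measurable_snd) |>.add_const _

@[fun_prop]
lemma measurable_residual (C : Matrix (Fin nx) (Fin ny) ℝ) (G : Matrix (Fin nx) (Fin nz) ℝ)
    (c : Vec nx) : Measurable (residual C G c) := by
  unfold residual
  have h : Measurable fun v : Vec nx => v.ofLp := by fun_prop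
  exact (h.comp measurable_fst).sub ((measurable_estimate C G c).comp measurable_snd)

lemma measurable_innovation (V : Matrix (Fin nx) (Fin nx) ℝ) (C : Matrix (Fin nx) (Fin ny) ℝ)
    {a : Vec nz → Fin nx → ℝ} (ha : Measurable a) : Measurable (innovation V C a) := by
  unfold innovation
  exact ((measurable_mulVec V).comp ((measurable_mulVec_ofLp C).comp measurable_fst)).sub
    (ha.comp measurable_snd)

section Coordinates

/-- The coordinates of `x` as linear forms on the source. -/
def coordX (i : Fin nx) : Src nx ny nz →ₗ[ℝ] ℝ where
  toFun s := s.1 i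
  map_add' _ _ := rfl
  map_smul' _ _ := rfl

/-- The coordinates of `y` as linear forms on the source. -/
def coordY (i : Fin ny) : Src nx ny nz →ₗ[ℝ] ℝ where
  toFun s := s.2.1 i
  map_add' _ _ := rfl
  map_smul' _ _ := rfl

/-- The coordinates of `z` as linear forms on the source. -/
def coordZ (i : Fin nz) : Src nx ny nz →ₗ[ℝ] ℝ where
  toFun s := s.2.2 i
  map_add' _ _ := rfl
  map_smul' _ _ := rfl

@[simp] lemma coordX_apply (i : Fin nx) (s : Src nx ny nz) : coordX i s = s.1 i := rfl
@[simp] lemma coordY_apply (i : Fin ny) (s : Src nx ny nz) : coordY i s = s.2.1 i := rfl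
@[simp] lemma coordZ_apply (i : Fin nz) (s : Src nx ny nz) : coordZ i s = s.2.2 i := rfl

variable {μ : Measure (Src nx ny nz)} [IsGaussian μ]

lemma exists_residual_indepFun :
    ∃ (C : Matrix (Fin nx) (Fin ny) ℝ) (G : Matrix (Fin nx) (Fin nz) ℝ) (c : Vec nx),
      IndepFun (residual C G c) (fun s => s.2) μ ∧ ∀ i, ∫ s, residual C G c s i ∂μ = 0 := by
  obtain ⟨A, hA⟩ := exists_indepFun_regression (μ := μ) coordX (Sum.elim coordY coordZ)
  let C : Matrix (Fin nx) (Fin ny) ℝ := Matrix.of fun i j => A i (Sum.inl j)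
  let G : Matrix (Fin nx) (Fin nz) ℝ := Matrix.of fun i j => A i (Sum.inr j)
  let c : Vec nx := WithLp.toLp 2 fun i =>
    ∫ s, (s.1 i - ∑ k, A i k * (Sum.elim coordY coordZ k : Src nx ny nz →ₗ[ℝ] ℝ) s) ∂μ
  have hres : residual C G c = fun s i =>
      (coordX i s - ∑ k, A i k * (Sum.elim coordY coordZ k : Src nx ny nz →ₗ[ℝ] ℝ) s) - c i := by
    ext s i
    simp [residual, estimate, C, G, Matrix.mulVec, dotProduct, sub_sub]
  refine ⟨C, G, c, ?_, fun i => ?_⟩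
  · have h2 : (fun s : Src nx ny nz => s.2) =
      (fun t : Fin ny ⊕ Fin nz → ℝ => ((WithLp.toLp 2 fun j => t (Sum.inl j) : Vec ny),
        (WithLp.toLp 2 fun j => t (Sum.inr j) : Vec nz))) ∘
        fun s j => (Sum.elim coordY coordZ j : Src nx ny nz →ₗ[ℝ] ℝ) s := by
      ext s : 1
      simp
    rw [h2, hres]
    exact hA.comp (φ := fun (e : Fin nx → ℝ) i => e i - c i)
      (ψ := fun t : Fin ny ⊕ Fin nz → ℝ => ((WithLp.toLp 2 fun j => t (Sum.inl j) : Vec ny),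
        (WithLp.toLp 2 fun j => t (Sum.inr j) : Vec nz))) (by fun_prop) (by fun_prop)
  · have hint : Integrable (fun s : Src nx ny nz => s.1 i - ∑ k, A i k *
        (Sum.elim coordY coordZ k : Src nx ny nz →ₗ[ℝ] ℝ) s) μ :=
      ((memLp_linearMap (coordX i)).sub (memLp_finsetSum _ fun k _ =>
        (memLp_linearMap _).const_mul _)).integrable one_le_two
    rw [hres]
    simp only [coordX_apply]
    rw [integral_sub hint (integrable_const _)]
    simp [c]

/-- The linear form `(C y + G z)ᵢ`. -/
def estimateLinear (C : Matrix (Fin nx) (Fin ny) ℝ) (G : Matrix (Fin nx) (Fin nz) ℝ) (i : Fin nx) :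
    Src nx ny nz →ₗ[ℝ] ℝ :=
  ∑ j, C i j • coordY j + ∑ j, G i j • coordZ j

lemma estimate_eq (C : Matrix (Fin nx) (Fin ny) ℝ) (G : Matrix (Fin nx) (Fin nz) ℝ) (c : Vec nx)
    (s : Src nx ny nz) (i : Fin nx) : estimate C G c s.2 i = estimateLinear C G i s + c i := by
  simp [estimate, estimateLinear, Matrix.mulVec, dotProduct]

lemma residual_eq (C : Matrix (Fin nx) (Fin ny) ℝ) (G : Matrix (Fin nx) (Fin nz) ℝ) (c : Vec nx)
    (s : Src nx ny nz) (i : Fin nx) :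
    residual C G c s i = (coordX i - estimateLinear C G i : Src nx ny nz →ₗ[ℝ] ℝ) s - c i := by
  simp [residual, estimate_eq, sub_sub]

lemma memLp_residual (C : Matrix (Fin nx) (Fin ny) ℝ) (G : Matrix (Fin nx) (Fin nz) ℝ)
    (c : Vec nx) (i : Fin nx) : MemLp (fun s => residual C G c s i) 2 μ := by
  simp_rw [residual_eq]
  exact (memLp_linearMap _).sub (memLp_const _)

lemma memLp_estimate (C : Matrix (Fin nx) (Fin ny) ℝ) (G : Matrix (Fin nx) (Fin nz) ℝ)
    (c : Vec nx) (i : Fin nx) : MemLp (fun s : Src nx ny nz => estimate C G c s.2 i) 2 μ := by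
  simp_rw [estimate_eq]
  exact (memLp_linearMap _).add (memLp_const _)

lemma condExp_eq_estimate {C : Matrix (Fin nx) (Fin ny) ℝ} {G : Matrix (Fin nx) (Fin nz) ℝ}
    {c : Vec nx} (hind : IndepFun (residual C G c) (fun s => s.2) μ)
    (h0 : ∀ i, ∫ s, residual C G c s i ∂μ = 0) (i : Fin nx) :
    (μ[fun w => w.1 i | MeasurableSpace.comap (fun w : Src nx ny nz => w.2) inferInstance])
      =ᵐ[μ] fun w => estimate C G c w.2 i := by
  have h := condExp_add_comp_of_indepFun (P := μ) (e := fun s => residual C G c s i)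
    (T := fun s : Src nx ny nz => s.2) (b := fun p => estimate C G c p i)
    (by fun_prop) ((memLp_residual C G c i).integrable one_le_two) measurable_snd (by fun_prop)
    ((memLp_estimate C G c i).integrable one_le_two)
    (hind.comp (measurable_pi_apply i) measurable_id) (h0 i)
  convert h using 3 with s
  simp [residual]

lemma exists_isEstimator (μ : Measure (Src nx ny nz)) [IsGaussian μ] :
    ∃ C G, IsEstimator μ C G := by
  obtain ⟨C, G, c, hind, h0⟩ := exists_residual_indepFun (μ := μ)
  exact ⟨C, G, c, condExp_eq_estimate hind h0⟩

/-- The error of the best estimate of `x` from `(y, z)` is independent of `(y, z)`. -/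
lemma IsEstimator.exists_residual {C : Matrix (Fin nx) (Fin ny) ℝ} {G : Matrix (Fin nx) (Fin nz) ℝ}
    (h : IsEstimator μ C G) : ∃ c : Vec nx,
      IndepFun (residual C G c) (fun s => s.2) μ ∧ (∀ i, ∫ s, residual C G c s i ∂μ = 0) ∧
      ∀ i j, ∫ s, residual C G c s i * residual C G c s j ∂μ = covXgivenYZ μ i j := by
  obtain ⟨c, hc⟩ := h
  obtain ⟨C₀, G₀, c₀, hind, h0⟩ := exists_residual_indepFun (μ := μ)
  -- The coefficients of the conditional mean need not be unique, but any two choices agree almost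
  -- surely, so the residual inherits the properties found for the regression coefficients.
  have hest : ∀ i, (fun s : Src nx ny nz => estimate C₀ G₀ c₀ s.2 i) =ᵐ[μ]
      fun s => estimate C G c s.2 i :=
    fun i => (condExp_eq_estimate hind h0 i).symm.trans (hc i)
  have hres : residual C₀ G₀ c₀ =ᵐ[μ] residual C G c := by
    filter_upwards [ae_all_iff.2 hest] with s hs
    ext i
    simp [residual, hs i]
  refine ⟨c, hind.congr hres Filter.EventuallyEq.rfl, fun i => ?_, fun i j => ?_⟩
  · rw [← h0 i]
    exact integral_congr_ae (hres.symm.mono fun s hs => by simp only [hs])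
  · simp only [covXgivenYZ, errorCov, Matrix.of_apply]
    refine integral_congr_ae ?_
    filter_upwards [hc i, hc j] with s hi hj
    rw [hi, hj]
    rfl

end Coordinates

end

section

/-! ### The innovation and its law -/

variable {nx ny nz : ℕ}

lemma integrable_fun_mul {Ω : Type*} [MeasurableSpace Ω] {P : Measure Ω} {X Y : Ω → ℝ}
    (hX : MemLp X 2 P) (hY : MemLp Y 2 P) : Integrable (fun ω => X ω * Y ω) P :=
  hX.integrable_mul hY

lemma integral_sum_mul_sum {Ω ι κ : Type*} [MeasurableSpace Ω] {P : Measure Ω} [Fintype ι]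
    [Fintype κ] {X : ι → Ω → ℝ} {Y : κ → Ω → ℝ} (hX : ∀ i, MemLp (X i) 2 P)
    (hY : ∀ i, MemLp (Y i) 2 P) (a : ι → ℝ) (b : κ → ℝ) :
    ∫ ω, (∑ i, a i * X i ω) * (∑ j, b j * Y j ω) ∂P =
      ∑ i, ∑ j, a i * b j * ∫ ω, X i ω * Y j ω ∂P := by
  have hint : ∀ i j, Integrable (fun ω => a i * b j * (X i ω * Y j ω)) P := fun i j =>
    ((hX i).integrable_mul (hY j)).const_mul _
  have h : ∀ ω, (∑ i, a i * X i ω) * (∑ j, b j * Y j ω) =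
      ∑ i, ∑ j, a i * b j * (X i ω * Y j ω) := fun ω => by
    rw [Finset.sum_mul_sum]
    exact Finset.sum_congr rfl fun i _ => Finset.sum_congr rfl fun j _ => by ring
  simp_rw [h]
  rw [integral_finsetSum _ fun i _ => integrable_finsetSum _ fun j _ => hint i j]
  refine Finset.sum_congr rfl fun i _ => ?_
  rw [integral_finsetSum _ fun j _ => hint i j]
  exact Finset.sum_congr rfl fun j _ => integral_const_mul _ _

lemma mul_mul_transpose_apply {m n : Type*} [Fintype n] (V : Matrix m n ℝ)
    (S : Matrix n n ℝ) (i j : m) :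
    (V * S * Vᵀ) i j = ∑ k, ∑ r, V i k * V j r * S k r := by
  simp only [Matrix.mul_apply, Matrix.transpose_apply, Finset.sum_mul]
  rw [Finset.sum_comm]
  exact Finset.sum_congr rfl fun k _ => Finset.sum_congr rfl fun r _ => by ring

/-- The probabilistic structure of a Gaussian source: the residual of the estimate of `x` from
`(y, z)` is independent of `(y, z)`, and the innovation of `V C y` with respect to `z` is
independent of `z` and has independent normal coordinates with variances `l`. -/
structure IsInnovationForm (μ : Measure (Src nx ny nz)) (C : Matrix (Fin nx) (Fin ny) ℝ)
    (G : Matrix (Fin nx) (Fin nz) ℝ) (c : Vec nx) (V : Matrix (Fin nx) (Fin nx) ℝ)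
    (l : Fin nx → ℝ) (a : Vec nz → Fin nx → ℝ) : Prop where
  measurable_offset : Measurable a
  memLp_estimate : ∀ i, MemLp (fun s : Src nx ny nz => estimate C G c s.2 i) 2 μ
  memLp_residual : ∀ i, MemLp (fun s => residual C G c s i) 2 μ
  residual_indep : IndepFun (residual C G c) (fun s => s.2) μ
  integral_residual : ∀ i, ∫ s, residual C G c s i ∂μ = 0
  integral_residual_mul : ∀ i j,
    ∫ s, residual C G c s i * residual C G c s j ∂μ = covXgivenYZ μ i j
  innovation_indep : IndepFun (fun s => innovation V C a s.2) (fun s => s.2.2) μ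
  map_innovation : μ.map (fun s => innovation V C a s.2) =
    Measure.pi fun i => gaussianReal 0 (l i).toNNReal
  nonneg : ∀ i, 0 ≤ l i

section Gaussian

variable {μ : Measure (Src nx ny nz)} [IsGaussian μ]

/-- The error of the best estimate of `x` from `z`. -/
lemma exists_residual_givenZ (μ : Measure (Src nx ny nz)) [IsGaussian μ] :
    ∃ (A : Matrix (Fin nx) (Fin nz) ℝ) (m : Vec nx),
      IndepFun (residual 0 A m) (fun s => s.2.2) μ ∧ (∀ i, ∫ s, residual 0 A m s i ∂μ = 0) ∧
      ∀ i j, ∫ s, residual 0 A m s i * residual 0 A m s j ∂μ = covXgivenZ μ i j := by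
  obtain ⟨A, hA⟩ := exists_indepFun_regression (μ := μ) coordX coordZ
  let m : Vec nx := WithLp.toLp 2 fun i => ∫ s, (s.1 i - ∑ k, A i k * s.2.2 k) ∂μ
  have hres : residual 0 A m = fun (s : Src nx ny nz) i =>
      (coordX i s - ∑ k, A i k * coordZ k s) - m i := by
    ext s i
    simp [residual, estimate, Matrix.mulVec, dotProduct, sub_sub]
  have hind : IndepFun (residual 0 A m) (fun s => s.2.2) μ := by
    have h2 : (fun s : Src nx ny nz => s.2.2) =
        (fun t : Fin nz → ℝ => (WithLp.toLp 2 t : Vec nz)) ∘ fun s j => coordZ j s := by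
      ext s : 1
      simp
    rw [h2, hres]
    exact hA.comp (φ := fun (e : Fin nx → ℝ) i => e i - m i)
      (ψ := fun t : Fin nz → ℝ => (WithLp.toLp 2 t : Vec nz)) (by fun_prop) (by fun_prop)
  have h0 : ∀ i, ∫ s, residual 0 A m s i ∂μ = 0 := by
    intro i
    have hint : Integrable (fun s : Src nx ny nz => s.1 i - ∑ k, A i k * s.2.2 k) μ :=
      ((memLp_linearMap (coordX i)).sub (memLp_finsetSum _ fun k _ =>
        (memLp_linearMap (coordZ k)).const_mul _)).integrable one_le_two
    rw [hres]
    simp only [coordX_apply, coordZ_apply]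
    rw [integral_sub hint (integrable_const _)]
    simp [m]
  refine ⟨A, m, hind, h0, fun i j => ?_⟩
  have hcond : ∀ i, (μ[fun w => w.1 i | MeasurableSpace.comap (fun w : Src nx ny nz => w.2.2)
      inferInstance]) =ᵐ[μ] fun w => (A *ᵥ w.2.2.ofLp + m.ofLp) i := by
    intro i
    have hb : Measurable fun z : Vec nz => (A *ᵥ z.ofLp + m.ofLp) i := by fun_prop
    have hest := memLp_estimate (μ := μ) (0 : Matrix (Fin nx) (Fin ny) ℝ) A m i
    have h := condExp_add_comp_of_indepFun (P := μ) (e := fun s => residual 0 A m s i)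
      (T := fun s : Src nx ny nz => s.2.2) (b := fun z => (A *ᵥ z.ofLp + m.ofLp) i)
      (by fun_prop) ((memLp_residual 0 A m i).integrable one_le_two) (by fun_prop) hb
      (by simpa [estimate] using hest.integrable one_le_two)
      (hind.comp (measurable_pi_apply i) measurable_id) (h0 i)
    convert h using 3 with s
    simp [residual, estimate]
  simp only [covXgivenZ, errorCov, Matrix.of_apply]
  refine integral_congr_ae ?_
  filter_upwards [hcond i, hcond j] with s hi hj
  rw [hi, hj]
  simp [residual, estimate]

lemma IsEstimator.exists_isInnovationForm {C : Matrix (Fin nx) (Fin ny) ℝ}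
    {G : Matrix (Fin nx) (Fin nz) ℝ} (h : IsEstimator μ C G) {V : Matrix (Fin nx) (Fin nx) ℝ}
    {l : Fin nx → ℝ} (hV : V * (covXgivenZ μ - covXgivenYZ μ) * Vᵀ = diagonal l) :
    ∃ c a, IsInnovationForm μ C G c V l a := by
  obtain ⟨c, hrind, hr0, hrr⟩ := h.exists_residual
  obtain ⟨A, m, heind, he0, hee⟩ := exists_residual_givenZ μ
  have hr2 := memLp_residual (μ := μ) C G c
  have he2 := memLp_residual (μ := μ) 0 A m
  -- With `E[x|z] = A z + m`, this offset makes `V C y - a(z)` equal to `V (E[x|y,z] - E[x|z])`,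
  -- that is, `V q` for the difference `q` of the two estimation errors.
  let a : Vec nz → Fin nx → ℝ := fun z =>
    V *ᵥ (A *ᵥ z.ofLp + m.ofLp - G *ᵥ z.ofLp - c.ofLp)
  have ha : Measurable a := by
    have : Continuous a := by fun_prop
    exact this.measurable
  let q : Fin nx → Src nx ny nz → ℝ := fun i s => residual 0 A m s i - residual C G c s i
  have hq2 : ∀ i, MemLp (q i) 2 μ := fun i => (he2 i).sub (hr2 i)
  have hq : ∀ i s, q i s = estimate C G c s.2 i - (A *ᵥ s.2.2.ofLp + m.ofLp) i := by
    intro i s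
    simp [q, residual, estimate]
  have hw : ∀ s i, innovation V C a s.2 i = ∑ k, V i k * q k s := by
    intro s i
    have : innovation V C a s.2 = V *ᵥ fun k => q k s := by
      simp only [innovation, a, ← Matrix.mulVec_sub]
      congr 1
      ext k
      simp [hq, estimate]
      ring
    rw [this]
    rfl
  have hqr : ∀ i j, ∫ s, q i s * residual C G c s j ∂μ = 0 := by
    intro i j
    have hind : IndepFun (q i) (fun s => residual C G c s j) μ := by
      have := hrind.symm.comp (φ := fun p : Vec ny × Vec nz => estimate C G c p i -
        (A *ᵥ p.2.ofLp + m.ofLp) i) (by fun_prop) (measurable_pi_apply j)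
      convert this using 1
      · ext s
        simp [hq]
      · rfl
    rw [hind.integral_fun_mul_eq_mul_integral (hq2 i).aestronglyMeasurable
      (hr2 j).aestronglyMeasurable, hr0 j, mul_zero]
  -- Pythagoras: the error given `z` is `q` plus the error given `(y,z)`, and these are orthogonal,
  -- so `q` has covariance `Σ_{x|z} - Σ_{x|yz}`.
  have hqq : ∀ i j, ∫ s, q i s * q j s ∂μ = (covXgivenZ μ - covXgivenYZ μ) i j := by
    intro i j
    rw [Matrix.sub_apply, ← hee i j, ← hrr i j, eq_sub_iff_add_eq]
    have h1 : ∀ s, residual 0 A m s i * residual 0 A m s j = q i s * q j s +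
        residual C G c s i * residual C G c s j + (q i s * residual C G c s j +
        q j s * residual C G c s i) := fun s => by simp only [q]; ring
    simp_rw [h1]
    have i1 := integrable_fun_mul (hq2 i) (hq2 j)
    have i2 := integrable_fun_mul (hr2 i) (hr2 j)
    have i3 := integrable_fun_mul (hq2 i) (hr2 j)
    have i4 := integrable_fun_mul (hq2 j) (hr2 i)
    rw [integral_add (i1.fun_add i2) (i3.fun_add i4), integral_add i1 i2, integral_add i3 i4,
      hqr i j, hqr j i, add_zero, add_zero]
  have hww : ∀ i j, ∫ s, innovation V C a s.2 i * innovation V C a s.2 j ∂μ =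
      diagonal l i j := by
    intro i j
    simp_rw [hw]
    rw [integral_sum_mul_sum hq2 hq2, ← hV, mul_mul_transpose_apply]
    simp_rw [hqq]
  have hw2 : ∀ i, MemLp (fun s : Src nx ny nz => innovation V C a s.2 i) 2 μ := by
    intro i
    simp_rw [hw]
    exact memLp_finsetSum _ fun k _ => (hq2 k).const_mul _
  have hw0 : ∀ i, ∫ s, innovation V C a s.2 i ∂μ = 0 := by
    intro i
    simp_rw [hw]
    rw [integral_finsetSum _ fun k _ => ((hq2 k).const_mul _).integrable one_le_two]
    refine Finset.sum_eq_zero fun k _ => ?_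
    rw [integral_const_mul, integral_sub ((he2 k).integrable one_le_two)
      ((hr2 k).integrable one_le_two), he0, hr0, sub_zero, mul_zero]
  -- The Gaussian lemmas concern linear forms, so the innovation is split into its linear part `W`
  -- and a constant `b`.
  let W : Fin nx → Src nx ny nz →ₗ[ℝ] ℝ := fun i =>
    ∑ k, V i k • (estimateLinear C G k - estimateLinear 0 A k)
  let b : Fin nx → ℝ := fun i => ∑ k, V i k * (m k - c k)
  have hWb : ∀ s i, innovation V C a s.2 i = W i s - b i := by
    intro s i
    simp only [hw, W, b, q, residual_eq, LinearMap.sum_apply, LinearMap.smul_apply,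
      LinearMap.sub_apply, smul_eq_mul, ← Finset.sum_sub_distrib]
    exact Finset.sum_congr rfl fun k _ => by ring
  have hWcov : ∀ i j, cov[fun s => W i s, fun s => W j s; μ] = diagonal l i j := by
    intro i j
    have h1 : ∀ i, (fun s => W i s) = fun s => innovation V C a s.2 i + b i := fun i => by
      ext s
      rw [hWb]
      ring
    rw [h1 i, h1 j, covariance_add_const_left ((hw2 i).integrable one_le_two),
      covariance_add_const_right ((hw2 j).integrable one_le_two),
      covariance_eq_sub (hw2 i) (hw2 j), hw0, zero_mul, sub_zero, ← hww i j]
    rfl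
  -- Both estimation errors are independent of `z`, which alone does not make their difference
  -- independent of `z`. It does make it uncorrelated with `z`, and Gaussianity gives the rest.
  have hWz : ∀ i j, cov[fun s => W i s, fun s => coordZ j s; μ] = 0 := by
    intro i j
    have h1 : (fun s => W i s) = fun s => (∑ k, V i k * q k s) + b i := by
      ext s
      rw [← hw, hWb]
      ring
    have hz2 : MemLp (fun s : Src nx ny nz => coordZ j s) 2 μ := memLp_linearMap (coordZ j)
    have hzm : Measurable fun z : Vec nz => z j := by fun_prop
    rw [h1, covariance_add_const_left ((memLp_finsetSum _ fun k _ =>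
      (hq2 k).const_mul _).integrable one_le_two),
      covariance_fun_sum_left (fun k => (hq2 k).const_mul _) hz2]
    refine Finset.sum_eq_zero fun k _ => ?_
    have h2 : cov[fun s => residual 0 A m s k, fun s => coordZ j s; μ] = 0 :=
      (heind.comp (measurable_pi_apply k) hzm).covariance_eq_zero (he2 k) hz2
    have h3 : cov[fun s => residual C G c s k, fun s => coordZ j s; μ] = 0 :=
      (hrind.comp (measurable_pi_apply k) (hzm.comp measurable_snd)).covariance_eq_zero (hr2 k) hz2
    rw [covariance_const_mul_left, covariance_fun_sub_left (he2 k) (hr2 k) hz2, h2, h3, sub_zero,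
      mul_zero]
  have hvar : ∀ i, Var[fun s => W i s; μ] = l i := by
    intro i
    rw [← covariance_self (memLp_linearMap (W i)).aestronglyMeasurable.aemeasurable, hWcov,
      diagonal_apply_eq]
  refine ⟨c, a, ha, memLp_estimate C G c, hr2, hrind, hr0, hrr, ?_, ?_, fun i => ?_⟩
  · have h1 := indepFun_linearMap (μ := μ) W coordZ hWz
    have h2 := h1.comp (φ := fun (e : Fin nx → ℝ) i => e i - b i)
      (ψ := fun t : Fin nz → ℝ => (WithLp.toLp 2 t : Vec nz)) (by fun_prop) (by fun_prop)
    convert h2 using 1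
    · ext s i
      exact hWb s i
    · rfl
  · have h1 := map_linearMap_sub_const_eq_pi (μ := μ) W b
      (fun i => by simp_rw [← hWb]; exact hw0 i)
      (fun i j hij => by rw [hWcov, diagonal_apply_ne _ hij])
    simp_rw [hvar] at h1
    rw [← h1]
    congr 1
    ext s i
    exact hWb s i
  · rw [← hvar i]
    exact variance_nonneg _ _

end Gaussian

end

section

/-! ### Moments of the innovation -/

section PiGaussian

variable {ι : Type*} [Fintype ι] (v : ι → NNReal)

lemma memLp_eval_pi_gaussianReal (i : ι) :
    MemLp (fun t : ι → ℝ => t i) 2 (Measure.pi fun i => gaussianReal 0 (v i)) :=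
  (memLp_id_gaussianReal (μ := 0) (v := v i) 2).comp_measurePreserving (measurePreserving_eval _ i)

lemma integral_eval_pi_gaussianReal (i : ι) :
    ∫ t, t i ∂(Measure.pi fun i => gaussianReal 0 (v i)) = 0 := by
  have h := integral_comp_eval (μ := fun i => gaussianReal 0 (v i)) (i := i) (f := fun t : ℝ => t)
    (by fun_prop)
  rw [h, integral_id_gaussianReal]

lemma integral_eval_mul_eval_pi_gaussianReal [DecidableEq ι] (i j : ι) :
    ∫ t, t i * t j ∂(Measure.pi fun i => gaussianReal 0 (v i)) =
      diagonal (fun i => (v i : ℝ)) i j := by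
  by_cases hij : i = j
  · subst hij
    have h := integral_comp_eval (μ := fun i => gaussianReal 0 (v i)) (i := i)
      (f := fun t : ℝ => t * t) (by fun_prop)
    rw [h, diagonal_apply_eq, ← variance_fun_id_gaussianReal (μ := 0) (v := v i),
      variance_of_integral_eq_zero (by fun_prop) integral_id_gaussianReal]
    simp_rw [sq]
  · have hind : iIndepFun (fun i (t : ι → ℝ) => t i) (Measure.pi fun i => gaussianReal 0 (v i)) :=
      iIndepFun_pi (X := fun i t => t) fun i => by fun_prop
    have hm := memLp_eval_pi_gaussianReal v
    rw [diagonal_apply_ne _ hij, (hind.indepFun hij).integral_fun_mul_eq_mul_integral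
      (hm i).aestronglyMeasurable (hm j).aestronglyMeasurable, integral_eval_pi_gaussianReal,
      zero_mul]

end PiGaussian

variable {nx ny nz : ℕ} {μ : Measure (Src nx ny nz)}
  {C : Matrix (Fin nx) (Fin ny) ℝ} {G : Matrix (Fin nx) (Fin nz) ℝ} {c : Vec nx}
  {V : Matrix (Fin nx) (Fin nx) ℝ} {l : Fin nx → ℝ} {a : Vec nz → Fin nx → ℝ}

namespace IsInnovationForm

lemma measurePreserving_innovation (h : IsInnovationForm μ C G c V l a) :
    MeasurePreserving (fun s : Src nx ny nz => innovation V C a s.2) μ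
      (Measure.pi fun i => gaussianReal 0 (l i).toNNReal) :=
  ⟨(measurable_innovation V C h.measurable_offset).comp measurable_snd, h.map_innovation⟩

lemma memLp_innovation (h : IsInnovationForm μ C G c V l a) (i : Fin nx) :
    MemLp (fun s : Src nx ny nz => innovation V C a s.2 i) 2 μ :=
  (memLp_eval_pi_gaussianReal _ i).comp_measurePreserving h.measurePreserving_innovation

lemma integral_innovation_mul (h : IsInnovationForm μ C G c V l a) (i j : Fin nx) :
    ∫ s, innovation V C a s.2 i * innovation V C a s.2 j ∂μ = diagonal l i j := by
  have h1 := integral_eval_mul_eval_pi_gaussianReal (fun i => (l i).toNNReal) i j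
  simp_rw [Real.coe_toNNReal _ (h.nonneg _)] at h1
  rw [← h1, ← h.map_innovation,
    integral_map h.measurePreserving_innovation.aemeasurable (by fun_prop)]

lemma memLp_coord (h : IsInnovationForm μ C G c V l a) (i : Fin nx) :
    MemLp (fun s : Src nx ny nz => s.1 i) 2 μ := by
  have := (h.memLp_residual i).add (h.memLp_estimate i)
  convert this using 1
  ext s
  simp [residual]

/-- The law of `(z, innovation)`, in the form required for conditional laws given `z`. -/
lemma map_prodMk_innovation [IsProbabilityMeasure μ] (h : IsInnovationForm μ C G c V l a) :
    μ.map (fun s => (s.2.2, innovation V C a s.2)) =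
      (μ.map fun s => s.2.2).prod (Measure.pi fun i => gaussianReal 0 (l i).toNNReal) := by
  have h1 := h.innovation_indep.symm
  rw [indepFun_iff_map_prod_eq_prod_map_map (by fun_prop)
    h.measurePreserving_innovation.aemeasurable] at h1
  rw [h1, h.map_innovation]

end IsInnovationForm

lemma lintegral_exp_gaussianLogRatio {v v' : ℝ} (hv : 0 < v) (hv' : 0 < v') (b : ℝ) :
    ∫⁻ t, ENNReal.ofReal (Real.exp (gaussianLogRatio v v' b t)) ∂(gaussianReal 0 v.toNNReal) =
      1 := by
  rw [← setLIntegral_univ, ← withDensity_apply _ MeasurableSet.univ,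
    withDensity_gaussianLogRatio hv hv', measure_univ]

lemma logSum_eq_sum_ite {n : ℕ} (a b : Fin n → ℝ) (hb : ∀ i, 0 < b i) :
    logSum a b = ∑ i, if b i < a i then 1 / 2 * Real.log (a i / b i) else 0 := by
  rw [logSum, Finset.mul_sum]
  refine Finset.sum_congr rfl fun i _ => ?_
  split_ifs with h
  · rw [max_eq_left ((one_le_div (hb i)).2 h.le)]
  · rw [max_eq_right ((div_le_one (hb i)).2 (not_lt.1 h)), Real.log_one, mul_zero]

/-! ### Converse: estimating the innovation from `(u,z)` -/

section Converse

variable {k : ℕ} {Q : Measure (Joint nx ny nz k)} [IsProbabilityMeasure Q]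
  {D : Matrix (Fin nx) (Fin nx) ℝ} {l' : Fin nx → ℝ}

lemma IsAdmissible.measurePreserving (hQ : IsAdmissible μ D Q) :
    MeasurePreserving (fun w : Joint nx ny nz k => (w.1, w.2.1, w.2.2.1)) Q μ :=
  ⟨by fun_prop, hQ.law⟩

/-- The best estimate of `V C y - a(z)` from `(u, z)` has mean square errors at most `l'`. -/
lemma IsInnovationForm.exists_estimate [IsProbabilityMeasure μ]
    (h : IsInnovationForm μ C G c V l a)
    (hV : V * (D - covXgivenYZ μ) * Vᵀ = diagonal l') (hQ : IsAdmissible μ D Q) :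
    ∃ f : Fin nx → Vec nz × Vec k → ℝ, (∀ i, Measurable (f i)) ∧
      (∀ i, MemLp (fun w : Joint nx ny nz k =>
        innovation V C a (w.2.1, w.2.2.1) i - f i (w.2.2.1, w.2.2.2)) 2 Q) ∧
      ∀ i, ∫ w, (innovation V C a (w.2.1, w.2.2.1) i - f i (w.2.2.1, w.2.2.2)) ^ 2 ∂Q ≤ l' i := by
  obtain ⟨κ, hκ, hch⟩ := exists_isChannelLaw hQ.law hQ.markov
  have hp := hQ.measurePreserving
  let xh : Fin nx → Joint nx ny nz k → ℝ := fun j => Q[fun w => w.1 j |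
    MeasurableSpace.comap (fun w : Joint nx ny nz k => (w.2.2.2, w.2.2.1)) inferInstance]
  have hx2 : ∀ j, MemLp (fun w : Joint nx ny nz k => w.1 j) 2 Q :=
    fun j => (h.memLp_coord j).comp_measurePreserving hp
  have hxh2 : ∀ j, MemLp (xh j) 2 Q := fun j => (hx2 j).condExp one_le_two
  have hxh : ∀ j, ∃ g : Vec k × Vec nz → ℝ, Measurable g ∧
      xh j = g ∘ fun w => (w.2.2.2, w.2.2.1) := fun j => by
    obtain ⟨g, hg, hgx⟩ := (stronglyMeasurable_condExp (μ := Q) (m := MeasurableSpace.comap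
      (fun w : Joint nx ny nz k => (w.2.2.2, w.2.2.1)) inferInstance) (f := fun w => w.1 j)).exists_eq_measurable_comp
    exact ⟨g, hg.measurable, hgx⟩
  choose g hg hgx using hxh
  let r : Fin nx → Joint nx ny nz k → ℝ := fun j w => residual C G c (w.1, w.2.1, w.2.2.1) j
  -- Thus `x - x̂ = r + d`, where `d = E[x|y,z] - x̂` is a function of `(y,z,u)`. By the Markov
  -- condition `r` is independent of `(y,z,u)`, so the two parts are orthogonal and `d` has second
  -- moments `distortion Q - Σ_{x|yz}`.
  let d : Fin nx → Joint nx ny nz k → ℝ := fun j w => estimate C G c (w.2.1, w.2.2.1) j - xh j w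
  have hr2 : ∀ j, MemLp (r j) 2 Q := fun j => (h.memLp_residual j).comp_measurePreserving hp
  have hd2 : ∀ j, MemLp (d j) 2 Q :=
    fun j => ((h.memLp_estimate j).comp_measurePreserving hp).sub (hxh2 j)
  have hrd : ∀ i j, ∫ w, r i w * d j w ∂Q = 0 := by
    intro i j
    have h1 := hch.indepFun (measurable_residual C G c) h.residual_indep
    have hm : Measurable fun p : Vec ny × Vec nz × Vec k =>
        estimate C G c (p.1, p.2.1) j - g j (p.2.2, p.2.1) := by
      have := hg j
      fun_prop
    have h2 : IndepFun (r i) (d j) Q := by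
      have := h1.comp (measurable_pi_apply i) hm
      convert this using 1
      · rfl
      · ext w
        simp [d, hgx]
    rw [h2.integral_fun_mul_eq_mul_integral (hr2 i).aestronglyMeasurable
      (hd2 j).aestronglyMeasurable]
    have : ∫ w, r i w ∂Q = 0 := by
      rw [← h.integral_residual i, ← hQ.law, integral_map (by fun_prop) (by fun_prop)]
    rw [this, zero_mul]
  have hrr : ∀ i j, ∫ w, r i w * r j w ∂Q = covXgivenYZ μ i j := by
    intro i j
    rw [← h.integral_residual_mul i j, ← hQ.law, integral_map (by fun_prop) (by fun_prop)]
  have hdd : ∀ i j, ∫ w, d i w * d j w ∂Q = (distortion Q - covXgivenYZ μ) i j := by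
    intro i j
    have h1 : distortion Q i j = ∫ w, (d i w * d j w + r i w * r j w) +
        (r i w * d j w + r j w * d i w) ∂Q := by
      simp only [distortion, errorCov, Matrix.of_apply]
      refine integral_congr_ae (ae_of_all _ fun w => ?_)
      change (w.1 i - xh i w) * (w.1 j - xh j w) = _
      simp only [d, r, residual, Pi.sub_apply]
      ring
    have i1 := integrable_fun_mul (hd2 i) (hd2 j)
    have i2 := integrable_fun_mul (hr2 i) (hr2 j)
    have i3 := integrable_fun_mul (hr2 i) (hd2 j)
    have i4 := integrable_fun_mul (hr2 j) (hd2 i)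
    rw [Matrix.sub_apply, h1, integral_add (i1.fun_add i2) (i3.fun_add i4), integral_add i1 i2,
      integral_add i3 i4, hrd, hrd, hrr]
    ring
  -- Chosen so that the innovation minus `f` is `V d`: the offset `a(z)` cancels.
  let f : Fin nx → Vec nz × Vec k → ℝ := fun i p =>
    ∑ j, V i j * (g j (p.2, p.1) - (G *ᵥ p.1.ofLp + c.ofLp) j) - a p.1 i
  have hf : ∀ i, Measurable (f i) := fun i => by
    have h1 := h.measurable_offset
    have h2 : ∀ j, Measurable fun p : Vec nz × Vec k => (G *ᵥ p.1.ofLp + c.ofLp) j :=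
      fun j => by fun_prop
    refine Measurable.sub (Finset.measurable_sum _ fun j _ => ?_) (by fun_prop)
    exact (((hg j).comp (by fun_prop)).sub (h2 j)).const_mul _
  have hfd : ∀ i w, innovation V C a (w.2.1, w.2.2.1) i - f i (w.2.2.1, w.2.2.2) =
      ∑ j, V i j * d j w := by
    intro i w
    simp only [innovation, f, d, hgx, Pi.sub_apply, Matrix.mulVec, dotProduct, estimate,
      Pi.add_apply, Function.comp_apply]
    rw [sub_sub_sub_cancel_right, ← Finset.sum_sub_distrib]
    exact Finset.sum_congr rfl fun j _ => by ring
  refine ⟨f, hf, fun i => ?_, fun i => ?_⟩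
  · simp_rw [hfd]
    exact memLp_finsetSum _ fun j _ => (hd2 j).const_mul _
  · simp_rw [hfd, sq]
    rw [integral_sum_mul_sum hd2 hd2]
    simp_rw [hdd]
    rw [← mul_mul_transpose_apply]
    -- The diagonal entries of the positive semidefinite matrix `V (D - distortion Q) Vᵀ` are `l' i`
    -- minus the mean square errors.
    have h1 := (hQ.distortion_le.mul_mul_conjTranspose_same V).diag_nonneg (i := i)
    rw [conjTranspose_eq_transpose_of_trivial] at h1
    have h2 : V * (D - distortion Q) * Vᵀ = diagonal l' - V * (distortion Q - covXgivenYZ μ) * Vᵀ := by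
      rw [← hV, ← Matrix.sub_mul, ← Matrix.mul_sub]
      congr 2
      abel
    rw [h2, Matrix.sub_apply, diagonal_apply_eq] at h1
    linarith

end Converse

end

section

/-! ### Lower and upper bounds for conditional mutual information -/

section Generic

variable {Ω 𝓨 𝓤 𝓩 𝓦 : Type*} [MeasurableSpace Ω]
  [MeasurableSpace 𝓨] [StandardBorelSpace 𝓨] [Nonempty 𝓨]
  [MeasurableSpace 𝓤] [StandardBorelSpace 𝓤] [Nonempty 𝓤] [MeasurableSpace 𝓩]
  [MeasurableSpace 𝓦] [MeasurableSpace.CountablyGenerated 𝓦]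
  {P : Measure Ω} [IsProbabilityMeasure P] {Y : Ω → 𝓨} {U : Ω → 𝓤} {Z : Ω → 𝓩}
  {N : Measure 𝓦} [IsProbabilityMeasure N]

/-- Gibbs' inequality for a test function of `(z, u)` and the statistic `φ(z,y)`. Under the
reference law this statistic has law `N` and is independent of `(z,u)`, so it suffices to normalize
`exp g` for each fixed `(z,u)`. -/
lemma ofReal_integral_le_condMutualInfo (hY : Measurable Y) (hU : Measurable U) (hZ : Measurable Z)
    {φ : 𝓩 × 𝓨 → 𝓦} (hφ : Measurable φ)
    (h : P.map (fun ω => (Z ω, φ (Z ω, Y ω))) = (P.map Z).prod N)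
    {g : (𝓩 × 𝓤) × 𝓦 → ℝ} (hg : Measurable g)
    (hone : ∀ q, ∫⁻ t, ENNReal.ofReal (Real.exp (g (q, t))) ∂N = 1)
    (hint : Integrable (fun ω => g ((Z ω, U ω), φ (Z ω, Y ω))) P) :
    ENNReal.ofReal (∫ ω, g ((Z ω, U ω), φ (Z ω, Y ω)) ∂P) ≤ condMutualInfo P Y U Z := by
  have hm : Measurable fun p : 𝓩 × 𝓨 × 𝓤 => ((p.1, p.2.2), φ (p.1, p.2.1)) := by fun_prop
  have hT : Measurable fun ω => (Z ω, Y ω, U ω) := by fun_prop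
  have hgm := hg.comp hm
  have : IsProbabilityMeasure (P.map Z) := Measure.isProbabilityMeasure_map hZ.aemeasurable
  have : IsProbabilityMeasure (P.map fun ω => (Z ω, Y ω, U ω)) :=
    Measure.isProbabilityMeasure_map hT.aemeasurable
  have hprod : ((P.map Z) ⊗ₘ condDistrib Y Z P).map (fun p => (p.1, φ p)) =
      (P.map Z).prod N := by
    rw [compProd_map_condDistrib hY.aemeasurable, Measure.map_map (by fun_prop) (by fun_prop), ← h]
    rfl
  have hI : ∫ ω, g ((Z ω, U ω), φ (Z ω, Y ω)) ∂P =
      ∫ p, g ((p.1, p.2.2), φ (p.1, p.2.1)) ∂(P.map fun ω => (Z ω, Y ω, U ω)) :=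
    (integral_map hT.aemeasurable hgm.aestronglyMeasurable).symm
  rw [hI]
  unfold condMutualInfo
  refine ofReal_integral_le_klDiv _ _ hgm
    ((integrable_map_measure hgm.aestronglyMeasurable hT.aemeasurable).2 hint) ?_
  have hF : Measurable fun q => ENNReal.ofReal (Real.exp (g q)) := by fun_prop
  have key := lintegral_map (μ := (P.map Z) ⊗ₘ (condDistrib Y Z P ×ₖ condDistrib U Z P)) hF hm
  rw [map_compProd_prod_eq_prod_left _ _ _ N hφ hprod, lintegral_prod _ hF.aemeasurable] at key
  simp_rw [hone] at key
  simpa using key.symm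

/-- For fixed `z` the map `ψ` recovers `u` from `φ(z,u)`, so the joint law and the reference law of
`(z,y,u)` are images under one map of laws of `(z,y,φ(z,u))` with relative density `exp g`. Data
processing gives this inequality; the opposite one will come from the converse. -/
lemma condMutualInfo_le_of_withDensity_exp (hY : Measurable Y) (hU : Measurable U)
    (hZ : Measurable Z) {φ : 𝓩 × 𝓤 → 𝓦} (hφ : Measurable φ) {ψ : 𝓩 × 𝓦 → 𝓤} (hψ : Measurable ψ)
    (hψφ : ∀ z u, ψ (z, φ (z, u)) = u)
    (h : P.map (fun ω => (Z ω, φ (Z ω, U ω))) = (P.map Z).prod N)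
    {g : (𝓩 × 𝓨) × 𝓦 → ℝ} (hg : Measurable g)
    (hlaw : P.map (fun ω => ((Z ω, Y ω), φ (Z ω, U ω))) =
      ((P.map fun ω => (Z ω, Y ω)).prod N).withDensity fun p => ENNReal.ofReal (Real.exp (g p)))
    (hint : Integrable (fun ω => g ((Z ω, Y ω), φ (Z ω, U ω))) P) :
    condMutualInfo P Y U Z ≤ ENNReal.ofReal (∫ ω, g ((Z ω, Y ω), φ (Z ω, U ω)) ∂P) := by
  have hT : Measurable fun ω => ((Z ω, Y ω), φ (Z ω, U ω)) := by fun_prop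
  have hm : Measurable fun p : 𝓩 × 𝓨 × 𝓤 => ((p.1, p.2.1), φ (p.1, p.2.2)) := by fun_prop
  have hn : Measurable fun q : (𝓩 × 𝓨) × 𝓦 => (q.1.1, q.1.2, ψ (q.1.1, q.2)) := by fun_prop
  have : IsProbabilityMeasure (P.map Z) := Measure.isProbabilityMeasure_map hZ.aemeasurable
  have : IsProbabilityMeasure (P.map fun ω => (Z ω, Y ω)) :=
    Measure.isProbabilityMeasure_map (by fun_prop)
  have hprob : IsProbabilityMeasure (P.map fun ω => ((Z ω, Y ω), φ (Z ω, U ω))) :=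
    Measure.isProbabilityMeasure_map hT.aemeasurable
  have hprod : ((P.map Z) ⊗ₘ condDistrib U Z P).map (fun p => (p.1, φ p)) =
      (P.map Z).prod N := by
    rw [compProd_map_condDistrib hU.aemeasurable, Measure.map_map (by fun_prop) (by fun_prop), ← h]
    rfl
  have hid : ∀ p : 𝓩 × 𝓨 × 𝓤, (p.1, p.2.1, ψ (p.1, φ (p.1, p.2.2))) = p := fun p => by
    rw [hψφ]
  have h1 : P.map (fun ω => (Z ω, Y ω, U ω)) =
      (P.map (fun ω => ((Z ω, Y ω), φ (Z ω, U ω)))).map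
        fun q => (q.1.1, q.1.2, ψ (q.1.1, q.2)) := by
    rw [Measure.map_map hn hT]
    refine congrArg (fun f => P.map f) (funext fun ω => (hid (Z ω, Y ω, U ω)).symm)
  have h2 : (P.map Z) ⊗ₘ (condDistrib Y Z P ×ₖ condDistrib U Z P) =
      ((P.map fun ω => (Z ω, Y ω)).prod N).map fun q => (q.1.1, q.1.2, ψ (q.1.1, q.2)) := by
    rw [← compProd_map_condDistrib (μ := P) (X := Z) (Y := Y) hY.aemeasurable,
      ← map_compProd_prod_eq_prod_right _ _ _ N hφ hprod, Measure.map_map hn hm]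
    conv_lhs => rw [← Measure.map_id (μ := (P.map Z) ⊗ₘ (condDistrib Y Z P ×ₖ condDistrib U Z P))]
    exact congrArg (fun f => Measure.map f _) (funext fun p => (hid p).symm)
  have hI : ∫ ω, g ((Z ω, Y ω), φ (Z ω, U ω)) ∂P =
      ∫ p, g p ∂(P.map fun ω => ((Z ω, Y ω), φ (Z ω, U ω))) :=
    (integral_map hT.aemeasurable hg.aestronglyMeasurable).symm
  have hint' : Integrable g (P.map fun ω => ((Z ω, Y ω), φ (Z ω, U ω))) :=
    (integrable_map_measure hg.aestronglyMeasurable hT.aemeasurable).2 hint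
  unfold condMutualInfo
  rw [h1, h2, hI]
  refine (klDiv_map_le _ _ hn).trans ?_
  rw [hlaw] at hprob hint' ⊢
  exact (klDiv_withDensity_exp _ hg hint').le

end Generic

end

section

variable {nx ny nz : ℕ} {μ : Measure (Src nx ny nz)}
  {C : Matrix (Fin nx) (Fin ny) ℝ} {G : Matrix (Fin nx) (Fin nz) ℝ} {c : Vec nx}
  {V : Matrix (Fin nx) (Fin nx) ℝ} {l : Fin nx → ℝ} {a : Vec nz → Fin nx → ℝ}

/-! ### Converse: the lower bound on the rate -/

section Converse

variable {k : ℕ} {Q : Measure (Joint nx ny nz k)}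
  {D : Matrix (Fin nx) (Fin nx) ℝ} {l' : Fin nx → ℝ}

lemma IsInnovationForm.map_joint_innovation [IsProbabilityMeasure μ]
    (h : IsInnovationForm μ C G c V l a)
    (hlaw : Q.map (fun w => (w.1, w.2.1, w.2.2.1)) = μ) :
    Q.map (fun w => (w.2.2.1, innovation V C a (w.2.1, w.2.2.1))) =
      (Q.map fun w => w.2.2.1).prod (Measure.pi fun i => gaussianReal 0 (l i).toNNReal) := by
  have hZ : Q.map (fun w => w.2.2.1) = μ.map fun s => s.2.2 := by
    rw [← hlaw, Measure.map_map (by fun_prop) (by fun_prop)]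
    rfl
  rw [hZ, ← h.map_prodMk_innovation, ← hlaw, Measure.map_map _ (by fun_prop)]
  · rfl
  · exact (measurable_snd.comp measurable_snd).prodMk h.measurePreserving_innovation.measurable

lemma IsInnovationForm.integral_joint_innovation_sq
    (h : IsInnovationForm μ C G c V l a)
    (hlaw : Q.map (fun w => (w.1, w.2.1, w.2.2.1)) = μ) (i : Fin nx) :
    ∫ w, innovation V C a (w.2.1, w.2.2.1) i ^ 2 ∂Q = l i := by
  have h1 := h.integral_innovation_mul i i
  have h2 : Measurable fun s : Src nx ny nz => innovation V C a s.2 i :=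
    (measurable_pi_apply i).comp h.measurePreserving_innovation.measurable
  have h3 : Measurable fun s : Src nx ny nz =>
      innovation V C a s.2 i * innovation V C a s.2 i := h2.mul h2
  rw [diagonal_apply_eq, ← hlaw, integral_map (by fun_prop) h3.aestronglyMeasurable] at h1
  simpa [sq] using h1

/-- The logarithm of the tilting density at the distortion level `v'`, if it is active. -/
@[irreducible] noncomputable def tilt (v v' b t : ℝ) : ℝ := if v' < v then gaussianLogRatio v v' b t else 0

lemma measurable_tilt (v v' : ℝ) : Measurable fun p : ℝ × ℝ => tilt v v' p.1 p.2 := by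
  unfold tilt
  split_ifs
  · exact measurable_gaussianLogRatio v v'
  · fun_prop

lemma measurable_tilt_comp {α : Type*} [MeasurableSpace α] (v v' : ℝ) {B T : α → ℝ}
    (hB : Measurable B) (hT : Measurable T) : Measurable fun x => tilt v v' (B x) (T x) :=
  (measurable_tilt v v').comp (hB.prodMk hT)

/-- Inactive coordinates are not tilted: a tilt would gain nothing there, and `v` may vanish. -/
lemma lintegral_exp_tilt {v v' : ℝ} (hv' : 0 < v') (b : ℝ) :
    ∫⁻ t, ENNReal.ofReal (Real.exp (tilt v v' b t)) ∂(gaussianReal 0 v.toNNReal) = 1 := by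
  unfold tilt
  split_ifs with hi
  · exact lintegral_exp_gaussianLogRatio (hv'.trans hi) hv' _
  · simp

/-- On an active coordinate the term `-(t - b)²/(2v')` has mean at least `-1/2`, and `t²/(2v)` has
mean exactly `1/2`; the constant `½ log (v/v')` remains. -/
lemma integrable_tilt_and_le_integral {Ω : Type*} [MeasurableSpace Ω] {P : Measure Ω}
    [IsProbabilityMeasure P] {v v' : ℝ} (hv' : 0 < v') {B T : Ω → ℝ} (hT : MemLp T 2 P)
    (hBT : MemLp (fun ω => T ω - B ω) 2 P) (hTv : ∫ ω, T ω ^ 2 ∂P = v)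
    (hle : ∫ ω, (T ω - B ω) ^ 2 ∂P ≤ v') :
    Integrable (fun ω => tilt v v' (B ω) (T ω)) P ∧
      (if v' < v then 1 / 2 * Real.log (v / v') else 0) ≤ ∫ ω, tilt v v' (B ω) (T ω) ∂P := by
  by_cases hi : v' < v
  · simp only [tilt, if_pos hi, gaussianLogRatio]
    have j1 := (hBT.integrable_sq).div_const (2 * v')
    have j2 := (hT.integrable_sq).div_const (2 * v)
    have j0 : Integrable (fun _ : Ω => 1 / 2 * Real.log (v / v')) P := integrable_const _
    have j3 : Integrable (fun ω => 1 / 2 * Real.log (v / v') - (T ω - B ω) ^ 2 / (2 * v')) P :=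
      j0.sub j1
    refine ⟨j3.add j2, ?_⟩
    rw [integral_add j3 j2, integral_sub j0 j1, integral_div, integral_div, hTv]
    have h1 : (∫ ω, (T ω - B ω) ^ 2 ∂P) / (2 * v') ≤ 1 / 2 := by
      rw [div_le_iff₀ (mul_pos two_pos hv')]
      linarith
    have h2 : v / (2 * v) = 1 / 2 := by
      have := (hv'.trans hi).ne'
      field_simp
    rw [h2]
    simp
    linarith
  · simp [tilt, if_neg hi]

/-- The sharp converse, with the values of `l` and `l'` paired as in the diagonalization. The trial
density pretends that, given `(z,u)`, the active coordinates of the innovation are independent `N(f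
i, l' i)`; only the second moments of the true errors enter. -/
lemma IsInnovationForm.le_rate [IsProbabilityMeasure Q] [IsProbabilityMeasure μ] (h : IsInnovationForm μ C G c V l a)
    (hl' : ∀ i, 0 < l' i) (hV : V * (D - covXgivenYZ μ) * Vᵀ = diagonal l')
    (hQ : IsAdmissible μ D Q) : ENNReal.ofReal (logSum l l') ≤ rate Q := by
  obtain ⟨f, hf, hf2, hfl⟩ := h.exists_estimate hV hQ
  have hinn : Measurable fun p : Vec nz × Vec ny => innovation V C a (p.2, p.1) :=
    (measurable_innovation V C h.measurable_offset).comp measurable_swap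
  have hterm := fun i => integrable_tilt_and_le_integral (hl' i)
    (T := fun w : Joint nx ny nz k => innovation V C a (w.2.1, w.2.2.1) i)
    ((h.memLp_innovation i).comp_measurePreserving hQ.measurePreserving) (hf2 i)
    (h.integral_joint_innovation_sq hQ.law i) (hfl i)
  have hm : ∀ i, Measurable fun q : (Vec nz × Vec k) × (Fin nx → ℝ) =>
      tilt (l i) (l' i) (f i q.1) (q.2 i) := fun i =>
    measurable_tilt_comp (l i) (l' i) ((hf i).comp measurable_fst)
      ((measurable_pi_apply i).comp measurable_snd)
  have hone : ∀ q : Vec nz × Vec k, ∫⁻ t, ENNReal.ofReal (Real.exp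
      (∑ i, tilt (l i) (l' i) (f i q) (t i))) ∂(Measure.pi fun i =>
        gaussianReal 0 (l i).toNNReal) = 1 := by
    intro q
    simp_rw [Real.exp_sum, ENNReal.ofReal_prod_of_nonneg fun i _ => (Real.exp_pos _).le]
    rw [lintegral_pi_prod (fun i => gaussianReal 0 (l i).toNNReal)
      (f := fun i t => ENNReal.ofReal (Real.exp (tilt (l i) (l' i) (f i q) t))) fun i => ?_]
    · exact Finset.prod_eq_one fun i _ => lintegral_exp_tilt (hl' i) _
    · exact (Real.measurable_exp.comp
        ((measurable_tilt (l i) (l' i)).comp measurable_prodMk_left)).ennreal_ofReal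
  have key := ofReal_integral_le_condMutualInfo (P := Q) (Y := fun w => w.2.1)
    (U := fun w => w.2.2.2) (Z := fun w => w.2.2.1) (by fun_prop) (by fun_prop) (by fun_prop) hinn
    (h.map_joint_innovation hQ.law)
    (g := fun q => ∑ i, tilt (l i) (l' i) (f i q.1) (q.2 i))
    (Finset.measurable_sum _ fun i _ => hm i) hone
    (integrable_finsetSum _ fun i _ => (hterm i).1)
  refine (ENNReal.ofReal_le_ofReal ?_).trans key
  rw [logSum_eq_sum_ite _ _ hl']
  refine le_of_le_of_eq ?_ (integral_finsetSum _ fun i _ => (hterm i).1).symm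
  exact Finset.sum_le_sum fun i _ => (hterm i).2

end Converse

end

section

/-! ### Affine images of Gaussian vectors -/

section Gaussian

variable {ι : Type*} [Fintype ι]

lemma map_const_mul_add_gaussianReal (v v' : NNReal) (b : ℝ) :
    ((gaussianReal 0 v).prod (gaussianReal 0 v')).map (fun p => b * p.1 + p.2) =
      gaussianReal 0 (b ^ 2 * v + v').toNNReal := by
  have h2 := gaussianReal_map_const_mul (μ := 0) (v := v) b
  rw [mul_zero] at h2
  have h := gaussianReal_conv_gaussianReal (m₁ := 0) (m₂ := 0) (v₁ := .mk (b ^ 2) (sq_nonneg b) * v)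
    (v₂ := v')
  rw [add_zero, ← h2, Measure.conv] at h
  have h4 : (b ^ 2 * v + v').toNNReal = .mk (b ^ 2) (sq_nonneg b) * v + v' := by
    ext
    rw [Real.coe_toNNReal _ (by positivity)]
    simp
  rw [h4, ← h]
  have h3 : ((gaussianReal 0 v).map (b * ·)).prod (gaussianReal 0 v') =
      ((gaussianReal 0 v).prod (gaussianReal 0 v')).map (Prod.map (b * ·) id) := by
    rw [← Measure.map_prod_map _ _ (by fun_prop) measurable_id, Measure.map_id]
  rw [h3, Measure.map_map (by fun_prop) (by fun_prop)]
  rfl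

lemma map_mul_add_pi_gaussianReal (v v' : ι → NNReal) (b : ι → ℝ) :
    ((Measure.pi fun i => gaussianReal 0 (v i)).prod (Measure.pi fun i => gaussianReal 0 (v' i))).map
      (fun p i => b i * p.1 i + p.2 i) =
      Measure.pi fun i => gaussianReal 0 (b i ^ 2 * v i + v' i).toNNReal := by
  symm
  refine Measure.pi_eq fun s hs => ?_
  have hm : Measurable fun p : (ι → ℝ) × (ι → ℝ) => fun i => b i * p.1 i + p.2 i := by fun_prop
  rw [Measure.map_apply hm (MeasurableSet.univ_pi hs),
    Measure.prod_apply (hm (MeasurableSet.univ_pi hs))]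
  have h1 : ∀ x : ι → ℝ, (Prod.mk x ⁻¹' ((fun p : (ι → ℝ) × (ι → ℝ) => fun i => b i * p.1 i + p.2 i) ⁻¹'
      Set.univ.pi s)) = Set.univ.pi fun i => {t | b i * x i + t ∈ s i} := by
    intro x
    ext t
    simp
  simp_rw [h1, Measure.pi_pi]
  rw [lintegral_pi_prod (fun i => gaussianReal 0 (v i))
    (f := fun i x => gaussianReal 0 (v' i) {t | b i * x + t ∈ s i}) fun i => ?_]
  · refine Finset.prod_congr rfl fun i _ => ?_
    rw [← map_const_mul_add_gaussianReal, Measure.map_apply (by fun_prop) (hs i),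
      Measure.prod_apply ((by fun_prop : Measurable fun p : ℝ × ℝ => b i * p.1 + p.2) (hs i))]
    rfl
  · exact measurable_measure_prodMk_left
      ((by fun_prop : Measurable fun p : ℝ × ℝ => b i * p.1 + p.2) (hs i))

lemma map_const_add_pi_gaussianReal (v : ι → NNReal) (b : ι → ℝ) :
    (Measure.pi fun i => gaussianReal 0 (v i)).map (fun t i => b i + t i) =
      Measure.pi fun i => gaussianReal (b i) (v i) := by
  rw [Measure.pi_map_pi fun i => by fun_prop]
  congr 1
  ext1 i
  rw [gaussianReal_map_const_add, zero_add]

/-- Rotating a centred Gaussian vector so that its coordinates become independent. -/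
lemma map_mulVec_multivariateGaussian {n : ℕ} {S B : Matrix (Fin n) (Fin n) ℝ} {N : Fin n → ℝ}
    (hS : S.PosSemidef) (hB : B * S * Bᵀ = diagonal N) :
    (multivariateGaussian (0 : Vec n) S).map (fun v => B *ᵥ v.ofLp) =
      Measure.pi fun i => gaussianReal 0 (N i).toNNReal := by
  let X : Fin n → Vec n →ₗ[ℝ] ℝ := fun i =>
    (innerSL ℝ (WithLp.toLp 2 (B i)) : Vec n →L[ℝ] ℝ).toLinearMap
  have hX : ∀ i v, X i v = (B *ᵥ v.ofLp) i := fun i v => by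
    simp [X, PiLp.inner_apply, Matrix.mulVec, dotProduct, mul_comm]
  have hcov : ∀ i j, cov[fun v => X i v, fun v => X j v; multivariateGaussian 0 S] =
      diagonal N i j := by
    intro i j
    have h := covarianceBilin_apply_eq_cov (μ := multivariateGaussian (0 : Vec n) S)
      IsGaussian.memLp_two_id (WithLp.toLp 2 (B i)) (WithLp.toLp 2 (B j))
    rw [covarianceBilin_multivariateGaussian hS] at h
    refine h.symm.trans ?_
    rw [← hB, Matrix.mul_assoc, Matrix.mul_apply]
    rfl
  have hmean : ∀ i, ∫ v, (X i v - 0) ∂(multivariateGaussian 0 S) = 0 := by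
    intro i
    have h := (innerSL ℝ (WithLp.toLp 2 (B i)) : Vec n →L[ℝ] ℝ).integral_comp_comm
      (μ := multivariateGaussian (0 : Vec n) S) (φ := fun v => v) IsGaussian.integrable_id
    simp only [sub_zero]
    refine h.trans ?_
    rw [integral_id_multivariateGaussian, map_zero]
  have key := map_linearMap_sub_const_eq_pi (μ := multivariateGaussian (0 : Vec n) S) X 0 hmean
    fun i j hij => by rw [hcov, diagonal_apply_ne _ hij]
  have hvar : ∀ i, Var[fun v => X i v; multivariateGaussian 0 S] = N i := fun i => by
    rw [← covariance_self, hcov, diagonal_apply_eq]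
    exact (X i).toContinuousLinearMap.continuous.measurable.aemeasurable
  simp_rw [hvar] at key
  rw [← key]
  congr 1
  ext v i
  simp [hX]

end Gaussian

end

section

/-! ### Gaussian test channels -/

variable {nx ny nz k : ℕ}

lemma measurable_testChannelMap (T : Matrix (Fin k) (Fin ny) ℝ) :
    Measurable fun p : Src nx ny nz × Vec k =>
      (p.1.1, p.1.2.1, p.1.2.2, mulVecE T p.1.2.1 + p.2) := by
  have h := measurable_mulVecE T
  fun_prop

lemma exists_isChannelLaw_gaussianTestChannel (μ : Measure (Src nx ny nz)) [IsProbabilityMeasure μ]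
    (T : Matrix (Fin k) (Fin ny) ℝ) (S : Matrix (Fin k) (Fin k) ℝ) :
    ∃ κ : Kernel (Vec ny) (Vec k), IsMarkovKernel κ ∧
      IsChannelLaw μ κ (gaussianTestChannel μ T S) := by
  have hT := measurable_mulVecE T
  have hφ : Measurable fun p : Vec ny × Vec k => mulVecE T p.1 + p.2 := by fun_prop
  refine ⟨(Kernel.id ×ₖ Kernel.const _ (multivariateGaussian 0 S)).map
    fun p => mulVecE T p.1 + p.2, Kernel.IsMarkovKernel.map _ hφ, fun F hF => ?_⟩
  have hm := measurable_testChannelMap (nx := nx) (nz := nz) T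
  rw [gaussianTestChannel, lintegral_map hF hm]
  refine (lintegral_prod _ (hF.comp hm).aemeasurable).trans (lintegral_congr fun s => ?_)
  simp only [Function.comp_apply]
  have hFs : Measurable fun u => F (s.1, s.2.1, s.2.2, u) := by fun_prop
  rw [Kernel.lintegral_map _ hφ _ hFs, Kernel.prod_apply, Kernel.id_apply, Kernel.const_apply,
    Measure.dirac_prod]
  exact (lintegral_map (hFs.comp hφ) measurable_prodMk_left).symm

/-- The noise `B u - A y` of a test channel, in the coordinates given by `B`. -/
@[irreducible] def channelNoise (B : Matrix (Fin k) (Fin k) ℝ) (A : Matrix (Fin k) (Fin ny) ℝ)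
    (w : Joint nx ny nz k) : Fin k → ℝ :=
  B *ᵥ w.2.2.2.ofLp - A *ᵥ w.2.1.ofLp

@[fun_prop]
lemma measurable_channelNoise (B : Matrix (Fin k) (Fin k) ℝ) (A : Matrix (Fin k) (Fin ny) ℝ) :
    Measurable (channelNoise (nx := nx) (nz := nz) B A) := by
  unfold channelNoise
  exact ((measurable_mulVec_ofLp B).comp (by fun_prop)).sub
    ((measurable_mulVec_ofLp A).comp (by fun_prop))

/-- For `u = T y + ν` one has `B u - B T y = B ν`, which is independent of the source and has
covariance `B S Bᵀ`. -/
lemma map_prodMk_channelNoise (μ : Measure (Src nx ny nz)) [IsProbabilityMeasure μ]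
    {T : Matrix (Fin k) (Fin ny) ℝ} {B S : Matrix (Fin k) (Fin k) ℝ} {N : Fin k → ℝ}
    (hS : S.PosSemidef) (hB : B * S * Bᵀ = diagonal N) :
    (gaussianTestChannel μ T S).map
      (fun w => ((w.1, w.2.1, w.2.2.1), channelNoise B (B * T) w)) =
      μ.prod (Measure.pi fun i => gaussianReal 0 (N i).toNNReal) := by
  have hm := measurable_testChannelMap (nx := nx) (nz := nz) T
  have hf : Measurable fun w : Joint nx ny nz k =>
      ((w.1, w.2.1, w.2.2.1), channelNoise B (B * T) w) := by fun_prop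
  rw [← map_mulVec_multivariateGaussian hS hB]
  conv_rhs => rw [← Measure.map_id (μ := μ)]
  rw [Measure.map_prod_map _ _ measurable_id (measurable_mulVec_ofLp B), gaussianTestChannel,
    Measure.map_map hf hm]
  congr 1
  ext p : 1
  simp only [Function.comp_apply, Prod.map, id_eq, channelNoise, mulVecE, WithLp.ofLp_add,
    Matrix.mulVec_add, Matrix.mulVec_mulVec, add_sub_cancel_left]

end

section

/-! ### Laws and second moments under additive noise -/

section AdditiveNoise

variable {ι α β : Type*} [Fintype ι] [MeasurableSpace α] [MeasurableSpace β]
  {μ : Measure α} [IsProbabilityMeasure μ] {N : ι → ℝ}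

lemma map_add_noise_eq_prod {ζ : α → β} (hζ : Measurable ζ) {ω : α → ι → ℝ} (hω : Measurable ω)
    {l : ι → ℝ} (hl : ∀ i, 0 ≤ l i) (hN : ∀ i, 0 ≤ N i) (J : ι → ℝ)
    (h : μ.map (fun s => (ζ s, ω s)) =
      (μ.map ζ).prod (Measure.pi fun i => gaussianReal 0 (l i).toNNReal)) :
    (μ.prod (Measure.pi fun i => gaussianReal 0 (N i).toNNReal)).map
      (fun p => (ζ p.1, fun i => J i * ω p.1 i + p.2 i)) =
      (μ.map ζ).prod (Measure.pi fun i => gaussianReal 0 (J i ^ 2 * l i + N i).toNNReal) := by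
  have := Measure.isProbabilityMeasure_map (μ := μ) hζ.aemeasurable
  have hconv := map_mul_add_pi_gaussianReal (fun i => (l i).toNNReal) (fun i => (N i).toNNReal) J
  simp only [Real.coe_toNNReal _ (hl _), Real.coe_toNNReal _ (hN _)] at hconv
  refine Measure.ext_of_lintegral _ fun F hF => ?_
  have h1 : Measurable fun q : (β × (ι → ℝ)) × (ι → ℝ) =>
      (q.1.1, fun i => J i * q.1.2 i + q.2 i) := by fun_prop
  have h2 : Measurable fun q : β × (ι → ℝ) =>
      ∫⁻ t, F (q.1, fun i => J i * q.2 i + t i)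
        ∂(Measure.pi fun i => gaussianReal 0 (N i).toNNReal) :=
    (hF.comp h1).lintegral_prod_right'
  rw [lintegral_map hF (by fun_prop), lintegral_prod _ (by fun_prop),
    lintegral_prod _ hF.aemeasurable]
  have h3 := lintegral_map (μ := μ) h2 (hζ.prodMk hω)
  rw [← h3, h, lintegral_prod _ h2.aemeasurable]
  refine lintegral_congr fun z => ?_
  have hFz : Measurable fun t => F (z, t) := by fun_prop
  rw [← hconv, lintegral_map hFz (by fun_prop), lintegral_prod _ (by fun_prop)]

/-- Given `q`, the shifted noise is a product of `N(b i, N i)`, and its density relative to the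
product of `N(0, N' i)` is the product of the likelihood ratios. The variances `N'` are free; later
they are those of the channel statistic. -/
lemma map_add_noise_eq_withDensity {q : α → β} (hq : Measurable q) {b : β → ι → ℝ}
    (hb : Measurable b) (hN : ∀ i, 0 < N i) {N' : ι → ℝ} (hN' : ∀ i, 0 < N' i) :
    (μ.prod (Measure.pi fun i => gaussianReal 0 (N i).toNNReal)).map
      (fun p => (q p.1, fun i => b (q p.1) i + p.2 i)) =
      ((μ.map q).prod (Measure.pi fun i => gaussianReal 0 (N' i).toNNReal)).withDensity
        fun p => ENNReal.ofReal
          (Real.exp (∑ i, gaussianLogRatio (N' i) (N i) (b p.1 i) (p.2 i))) := by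
  have := Measure.isProbabilityMeasure_map (μ := μ) hq.aemeasurable
  have hr : ∀ i, Measurable fun p : β × (ι → ℝ) =>
      gaussianLogRatio (N' i) (N i) (b p.1 i) (p.2 i) := fun i =>
    (measurable_gaussianLogRatio (N' i) (N i)).comp
      ((by fun_prop : Measurable fun p : β × (ι → ℝ) => b p.1 i).prodMk (by fun_prop))
  have hd : Measurable fun p : β × (ι → ℝ) => ENNReal.ofReal
      (Real.exp (∑ i, gaussianLogRatio (N' i) (N i) (b p.1 i) (p.2 i))) :=
    (Real.measurable_exp.comp (Finset.measurable_sum _ fun i _ => hr i)).ennreal_ofReal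
  refine Measure.ext_of_lintegral _ fun F hF => ?_
  have hFb : Measurable fun x : β × (ι → ℝ) => F (x.1, fun i => b x.1 i + x.2 i) := by fun_prop
  rw [lintegral_map hF (by fun_prop), lintegral_prod _ (by fun_prop),
    lintegral_withDensity_eq_lintegral_mul _ hd hF,
    lintegral_prod _ (hd.mul hF).aemeasurable,
    lintegral_map (hd.mul hF).lintegral_prod_right' hq]
  refine lintegral_congr fun s => ?_
  simp only [Pi.mul_apply]
  have hFs : Measurable fun t => F (q s, t) := by fun_prop
  have h1 := lintegral_map (μ := Measure.pi fun i => gaussianReal 0 (N i).toNNReal) hFs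
    (by fun_prop : Measurable fun (t : ι → ℝ) i => b (q s) i + t i)
  have hri : ∀ i, Measurable fun t => ENNReal.ofReal (Real.exp
      (gaussianLogRatio (N' i) (N i) (b (q s) i) t)) := fun i =>
    (Real.measurable_exp.comp ((measurable_gaussianLogRatio (N' i) (N i)).comp
      measurable_prodMk_left)).ennreal_ofReal
  have hp : Measurable fun t : ι → ℝ => ∏ i, ENNReal.ofReal (Real.exp
      (gaussianLogRatio (N' i) (N i) (b (q s) i) (t i))) :=
    Finset.measurable_prod _ fun i _ => (hri i).comp (measurable_pi_apply i)
  rw [← h1, map_const_add_pi_gaussianReal, ← pi_withDensity _ _ hri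
    fun i => withDensity_gaussianLogRatio (hN' i) (hN i) (b (q s) i),
    lintegral_withDensity_eq_lintegral_mul _ hp hFs]
  refine lintegral_congr fun t => ?_
  rw [Pi.mul_apply, Real.exp_sum, ENNReal.ofReal_prod_of_nonneg fun i _ => (Real.exp_pos _).le]

lemma integral_mul_add_mul_add {Ω ι : Type*} [MeasurableSpace Ω] [DecidableEq ι] {P : Measure Ω}
    {w n : ι → Ω → ℝ} (hw : ∀ i, MemLp (w i) 2 P) (hn : ∀ i, MemLp (n i) 2 P) {l N : ι → ℝ}
    (hww : ∀ i j, ∫ ω, w i ω * w j ω ∂P = diagonal l i j)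
    (hnn : ∀ i j, ∫ ω, n i ω * n j ω ∂P = diagonal N i j)
    (hwn : ∀ i j, ∫ ω, w i ω * n j ω ∂P = 0) (α β : ι → ℝ) (i j : ι) :
    ∫ ω, (α i * w i ω + β i * n i ω) * (α j * w j ω + β j * n j ω) ∂P =
      diagonal (fun i => α i ^ 2 * l i + β i ^ 2 * N i) i j := by
  have h : ∀ ω, (α i * w i ω + β i * n i ω) * (α j * w j ω + β j * n j ω) =
      (α i * α j * (w i ω * w j ω) + β i * β j * (n i ω * n j ω)) +
        (α i * β j * (w i ω * n j ω) + α j * β i * (w j ω * n i ω)) := fun ω => by ring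
  simp_rw [h]
  have i1 := (integrable_fun_mul (hw i) (hw j)).const_mul (α i * α j)
  have i2 := (integrable_fun_mul (hn i) (hn j)).const_mul (β i * β j)
  have i3 := (integrable_fun_mul (hw i) (hn j)).const_mul (α i * β j)
  have i4 := (integrable_fun_mul (hw j) (hn i)).const_mul (α j * β i)
  rw [integral_add (i1.fun_add i2) (i3.fun_add i4), integral_add i1 i2, integral_add i3 i4]
  simp_rw [integral_const_mul, hwn, hww, hnn, diagonal_apply]
  split_ifs with hij
  · subst hij
    ring
  · ring

end AdditiveNoise

/-! ### Optimality of the conditional mean -/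

section Optimality

variable {Ω : Type*} {m mΩ : MeasurableSpace Ω} {P : Measure Ω}

lemma integral_sub_condExp_mul [IsFiniteMeasure P] (hm : m ≤ mΩ) {X Y : Ω → ℝ}
    (hX : MemLp X 2 P) (hY : MemLp Y 2 P) (hYm : StronglyMeasurable[m] Y) :
    ∫ ω, (X ω - (P[X | m]) ω) * Y ω ∂P = 0 := by
  have hE : MemLp (P[X | m]) 2 P := hX.condExp one_le_two
  have hXY := integrable_fun_mul hX hY
  have h1 : ∫ ω, X ω * Y ω ∂P = ∫ ω, (P[X | m]) ω * Y ω ∂P := by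
    rw [← integral_condExp hm (f := fun ω => X ω * Y ω)]
    refine integral_congr_ae ?_
    exact condExp_mul_of_stronglyMeasurable_right hYm hXY (hX.integrable one_le_two)
  simp_rw [sub_mul]
  rw [integral_sub hXY (integrable_fun_mul hE hY), h1, sub_self]

lemma posSemidef_integral_mul {n : ℕ} {d : Fin n → Ω → ℝ} (hd : ∀ i, MemLp (d i) 2 P) :
    (Matrix.of fun i j => ∫ ω, d i ω * d j ω ∂P).PosSemidef := by
  refine PosSemidef.of_dotProduct_mulVec_nonneg ?_ fun b => ?_
  · ext i j
    simp [mul_comm]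
  · have h := integral_sum_mul_sum hd hd b b
    have h2 : 0 ≤ ∫ ω, (∑ i, b i * d i ω) * (∑ j, b j * d j ω) ∂P :=
      integral_nonneg fun ω => mul_self_nonneg _
    rw [h] at h2
    refine h2.trans_eq ?_
    simp only [dotProduct, mulVec, Finset.mul_sum, star_trivial, Matrix.of_apply]
    exact Finset.sum_congr rfl fun i _ => Finset.sum_congr rfl fun j _ => by ring

/-- The conditional mean has the smallest error covariance. -/
lemma posSemidef_sub_errorCov [IsFiniteMeasure P] {n : ℕ} {x : Ω → Vec n} (hm : m ≤ mΩ)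
    (hx : ∀ i, MemLp (fun ω => x ω i) 2 P) {g : Fin n → Ω → ℝ}
    (hg : ∀ i, MemLp (g i) 2 P) (hgm : ∀ i, StronglyMeasurable[m] (g i)) :
    ((Matrix.of fun i j => ∫ ω, (x ω i - g i ω) * (x ω j - g j ω) ∂P) -
      errorCov P x m).PosSemidef := by
  let E : Fin n → Ω → ℝ := fun i => P[fun ω => x ω i | m]
  have hE : ∀ i, MemLp (E i) 2 P := fun i => (hx i).condExp one_le_two
  have hd : ∀ i, MemLp (fun ω => E i ω - g i ω) 2 P := fun i => (hE i).sub (hg i)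
  have hr : ∀ i, MemLp (fun ω => x ω i - E i ω) 2 P := fun i => (hx i).sub (hE i)
  -- The error of the conditional mean is orthogonal to every square integrable `m`-measurable
  -- variable, so the difference of the two error covariances is the Gram matrix of `E - g`.
  have hcross : ∀ i j, ∫ ω, (x ω i - E i ω) * (E j ω - g j ω) ∂P = 0 := fun i j =>
    integral_sub_condExp_mul hm (hx i) (hd j) (stronglyMeasurable_condExp.sub (hgm j))
  convert posSemidef_integral_mul hd using 1
  ext i j
  simp only [Matrix.sub_apply, Matrix.of_apply, errorCov]
  have h : ∀ ω, (x ω i - g i ω) * (x ω j - g j ω) =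
      ((x ω i - E i ω) * (x ω j - E j ω) + (E i ω - g i ω) * (E j ω - g j ω)) +
        ((x ω i - E i ω) * (E j ω - g j ω) + (x ω j - E j ω) * (E i ω - g i ω)) :=
    fun ω => by ring
  simp_rw [h]
  have i1 := integrable_fun_mul (hr i) (hr j)
  have i2 := integrable_fun_mul (hd i) (hd j)
  have i3 := integrable_fun_mul (hr i) (hd j)
  have i4 := integrable_fun_mul (hr j) (hd i)
  rw [integral_add (i1.fun_add i2) (i3.fun_add i4), integral_add i1 i2, integral_add i3 i4,
    hcross, hcross]
  simp [E]

end Optimality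

end

section

/-! ### The decoder's statistic and its noise -/

variable {nx ny nz k : ℕ} {μ : Measure (Src nx ny nz)}
  {C : Matrix (Fin nx) (Fin ny) ℝ} {G : Matrix (Fin nx) (Fin nz) ℝ} {c : Vec nx}
  {V : Matrix (Fin nx) (Fin nx) ℝ} {l : Fin nx → ℝ} {a : Vec nz → Fin nx → ℝ}
  {Q : Measure (Joint nx ny nz nx)}
  {B : Matrix (Fin nx) (Fin nx) ℝ} {J N : Fin nx → ℝ}

/-- The statistic `B u - J a(z)` of the side information and the channel output. -/
@[irreducible] def statistic (B : Matrix (Fin nx) (Fin nx) ℝ) (J : Fin nx → ℝ)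
    (a : Vec nz → Fin nx → ℝ) (p : Vec nz × Vec nx) : Fin nx → ℝ :=
  B *ᵥ p.2.ofLp - diagonal J *ᵥ a p.1

lemma measurable_statistic (B : Matrix (Fin nx) (Fin nx) ℝ) (J : Fin nx → ℝ)
    (ha : Measurable a) : Measurable (statistic B J a) := by
  unfold statistic
  exact ((measurable_mulVec_ofLp B).comp measurable_snd).sub
    ((measurable_mulVec (diagonal J)).comp (ha.comp measurable_fst))

/-- The decoder knows `z`; subtracting `J a(z)` turns the signal `J V C y` into `J` times the
innovation. -/
lemma statistic_eq (w : Joint nx ny nz nx) (i : Fin nx) :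
    statistic B J a (w.2.2.1, w.2.2.2) i =
      J i * innovation V C a (w.2.1, w.2.2.1) i + channelNoise B (diagonal J * V * C) w i := by
  unfold statistic innovation channelNoise
  simp only [Pi.sub_apply, ← Matrix.mulVec_mulVec, mulVec_diagonal]
  ring

/-- `Q` is the law of the source `μ` with an output whose statistic `B u` is `J V C y` plus
independent centred normal coordinates with variances `N`. -/
structure IsAdditiveNoise (μ : Measure (Src nx ny nz)) (C : Matrix (Fin nx) (Fin ny) ℝ)
    (V B : Matrix (Fin nx) (Fin nx) ℝ) (J N : Fin nx → ℝ) (Q : Measure (Joint nx ny nz nx)) :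
    Prop where
  law : Q.map (fun w => (w.1, w.2.1, w.2.2.1)) = μ
  map_noise : Q.map
      (fun w => ((w.1, w.2.1, w.2.2.1), channelNoise B (diagonal J * V * C) w)) =
    μ.prod (Measure.pi fun i => gaussianReal 0 (N i).toNNReal)
  pos : ∀ i, 0 < N i
  exists_channel : ∃ κ : Kernel (Vec ny) (Vec nx), IsMarkovKernel κ ∧ IsChannelLaw μ κ Q

lemma isAdditiveNoise_gaussianTestChannel [IsProbabilityMeasure μ]
    {T : Matrix (Fin nx) (Fin ny) ℝ} {S : Matrix (Fin nx) (Fin nx) ℝ} (hS : S.PosSemidef)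
    (hB : B * S * Bᵀ = diagonal N) (hT : B * T = diagonal J * V * C) (hN : ∀ i, 0 < N i) :
    IsAdditiveNoise μ C V B J N (gaussianTestChannel μ T S) := by
  obtain ⟨κ, hκ, hch⟩ := exists_isChannelLaw_gaussianTestChannel μ T S
  exact ⟨hch.law, hT ▸ map_prodMk_channelNoise μ hS hB, hN, κ, hκ, hch⟩

namespace IsAdditiveNoise

lemma measurePreserving (hQ : IsAdditiveNoise μ C V B J N Q) :
    MeasurePreserving (fun w : Joint nx ny nz nx => (w.1, w.2.1, w.2.2.1)) Q μ :=
  ⟨by fun_prop, hQ.law⟩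

lemma integral_innovation_mul (h : IsInnovationForm μ C G c V l a)
    (hQ : IsAdditiveNoise μ C V B J N Q) (i j : Fin nx) :
    ∫ w, innovation V C a (w.2.1, w.2.2.1) i * innovation V C a (w.2.1, w.2.2.1) j ∂Q =
      diagonal l i j := by
  have hm : ∀ i, Measurable fun s : Src nx ny nz => innovation V C a s.2 i := fun i =>
    (measurable_pi_apply i).comp h.measurePreserving_innovation.measurable
  have hm2 : Measurable fun s : Src nx ny nz => innovation V C a s.2 i * innovation V C a s.2 j :=
    (hm i).mul (hm j)
  rw [← h.integral_innovation_mul i j, ← hQ.law, integral_map (by fun_prop)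
    hm2.aestronglyMeasurable]

variable [IsProbabilityMeasure μ]

lemma measurePreserving_noise (hQ : IsAdditiveNoise μ C V B J N Q) :
    MeasurePreserving (channelNoise B (diagonal J * V * C)) Q
      (Measure.pi fun i => gaussianReal 0 (N i).toNNReal) := by
  refine ⟨by fun_prop, ?_⟩
  have h := congrArg Measure.snd hQ.map_noise
  rw [Measure.snd_prod, Measure.snd_map_prodMk (by fun_prop)] at h
  exact h

lemma memLp_noise (hQ : IsAdditiveNoise μ C V B J N Q) (i : Fin nx) :
    MemLp (fun w => channelNoise B (diagonal J * V * C) w i) 2 Q :=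
  (memLp_eval_pi_gaussianReal _ i).comp_measurePreserving hQ.measurePreserving_noise

lemma integral_noise (hQ : IsAdditiveNoise μ C V B J N Q) (i : Fin nx) :
    ∫ w, channelNoise B (diagonal J * V * C) w i ∂Q = 0 := by
  have hm : Measurable fun t : Fin nx → ℝ => t i := by fun_prop
  rw [← integral_eval_pi_gaussianReal (fun i => (N i).toNNReal) i,
    ← hQ.measurePreserving_noise.map_eq, integral_map (by fun_prop) hm.aestronglyMeasurable]

lemma integral_noise_mul (hQ : IsAdditiveNoise μ C V B J N Q) (i j : Fin nx) :
    ∫ w, channelNoise B (diagonal J * V * C) w i * channelNoise B (diagonal J * V * C) w j ∂Q =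
      diagonal N i j := by
  have h := integral_eval_mul_eval_pi_gaussianReal (fun i => (N i).toNNReal) i j
  simp only [Real.coe_toNNReal _ (hQ.pos _).le] at h
  have hm : Measurable fun t : Fin nx → ℝ => t i * t j := by fun_prop
  rw [← h, ← hQ.measurePreserving_noise.map_eq, integral_map (by fun_prop) hm.aestronglyMeasurable]

lemma indepFun_noise [IsProbabilityMeasure Q] (hQ : IsAdditiveNoise μ C V B J N Q) :
    IndepFun (fun w : Joint nx ny nz nx => (w.1, w.2.1, w.2.2.1))
      (channelNoise B (diagonal J * V * C)) Q := by
  rw [indepFun_iff_map_prod_eq_prod_map_map (by fun_prop) (by fun_prop), hQ.law,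
    hQ.measurePreserving_noise.map_eq]
  exact hQ.map_noise

lemma integral_innovation_mul_noise [IsProbabilityMeasure Q]
    (h : IsInnovationForm μ C G c V l a) (hQ : IsAdditiveNoise μ C V B J N Q) (i j : Fin nx) :
    ∫ w, innovation V C a (w.2.1, w.2.2.1) i * channelNoise B (diagonal J * V * C) w j ∂Q = 0 := by
  have hm : Measurable fun s : Src nx ny nz => innovation V C a s.2 i :=
    (measurable_pi_apply i).comp h.measurePreserving_innovation.measurable
  have hind : IndepFun (fun w : Joint nx ny nz nx => innovation V C a (w.2.1, w.2.2.1) i)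
      (fun w => channelNoise B (diagonal J * V * C) w j) Q :=
    hQ.indepFun_noise.comp hm (measurable_pi_apply j)
  rw [hind.integral_fun_mul_eq_mul_integral
    ((h.memLp_innovation i).comp_measurePreserving hQ.measurePreserving).aestronglyMeasurable
    (hQ.memLp_noise j).aestronglyMeasurable, hQ.integral_noise, mul_zero]

lemma integral_comb_mul_comb [IsProbabilityMeasure Q] (h : IsInnovationForm μ C G c V l a)
    (hQ : IsAdditiveNoise μ C V B J N Q) (α β : Fin nx → ℝ) (i j : Fin nx) :
    ∫ w, (α i * innovation V C a (w.2.1, w.2.2.1) i +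
        β i * channelNoise B (diagonal J * V * C) w i) *
      (α j * innovation V C a (w.2.1, w.2.2.1) j +
        β j * channelNoise B (diagonal J * V * C) w j) ∂Q =
      diagonal (fun i => α i ^ 2 * l i + β i ^ 2 * N i) i j :=
  integral_mul_add_mul_add (w := fun i w => innovation V C a (w.2.1, w.2.2.1) i)
    (n := fun i w => channelNoise B (diagonal J * V * C) w i)
    (fun i => (h.memLp_innovation i).comp_measurePreserving hQ.measurePreserving) hQ.memLp_noise
    (hQ.integral_innovation_mul h) hQ.integral_noise_mul (hQ.integral_innovation_mul_noise h) α β i j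

end IsAdditiveNoise

end

section

variable {nx ny nz : ℕ} {μ : Measure (Src nx ny nz)} [IsProbabilityMeasure μ]
  {C : Matrix (Fin nx) (Fin ny) ℝ} {G : Matrix (Fin nx) (Fin nz) ℝ} {c : Vec nx}
  {V : Matrix (Fin nx) (Fin nx) ℝ} {l : Fin nx → ℝ} {a : Vec nz → Fin nx → ℝ}
  {Q : Measure (Joint nx ny nz nx)} [IsProbabilityMeasure Q]
  {B : Matrix (Fin nx) (Fin nx) ℝ} {J N : Fin nx → ℝ}

/-! ### Direct part: the distortion of the linear decoder -/

namespace IsAdditiveNoise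

/-- Estimating the innovation by `K` times the statistic leaves the error `(1 - K J) w - K n`, whose
coordinates are uncorrelated. The residual is orthogonal to it because it is independent of
`(y,z,u)`. The matrix `W` plays the role of the inverse of `V`. -/
lemma integral_error_mul_error (h : IsInnovationForm μ C G c V l a)
    (hQ : IsAdditiveNoise μ C V B J N Q) (W : Matrix (Fin nx) (Fin nx) ℝ) (K : Fin nx → ℝ)
    (i j : Fin nx) :
    ∫ w, (residual C G c (w.1, w.2.1, w.2.2.1) i + ∑ p, W i p *
          (innovation V C a (w.2.1, w.2.2.1) p - K p * statistic B J a (w.2.2.1, w.2.2.2) p)) *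
      (residual C G c (w.1, w.2.1, w.2.2.1) j + ∑ p, W j p *
          (innovation V C a (w.2.1, w.2.2.1) p - K p * statistic B J a (w.2.2.1, w.2.2.2) p)) ∂Q =
      (covXgivenYZ μ + W * diagonal (fun i => (1 - K i * J i) ^ 2 * l i + K i ^ 2 * N i) * Wᵀ :
        Matrix (Fin nx) (Fin nx) ℝ) i j := by
  obtain ⟨κ, hκ, hch⟩ := hQ.exists_channel
  have hp := hQ.measurePreserving
  have ha := h.measurable_offset
  have hinn := measurable_innovation V C ha
  have hst := measurable_statistic B J ha
  let r : Fin nx → Joint nx ny nz nx → ℝ := fun i w => residual C G c (w.1, w.2.1, w.2.2.1) i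
  let e : Fin nx → Joint nx ny nz nx → ℝ := fun p w =>
    innovation V C a (w.2.1, w.2.2.1) p - K p * statistic B J a (w.2.2.1, w.2.2.2) p
  have he : ∀ p w, e p w = (1 - K p * J p) * innovation V C a (w.2.1, w.2.2.1) p +
      -K p * channelNoise B (diagonal J * V * C) w p := fun p w => by
    simp only [e]
    rw [statistic_eq (V := V) (C := C)]
    ring
  have hee : ∀ p q, ∫ w, e p w * e q w ∂Q =
      diagonal (fun i => (1 - K i * J i) ^ 2 * l i + K i ^ 2 * N i) p q := by
    intro p q
    simp_rw [he]
    rw [hQ.integral_comb_mul_comb h (fun p => 1 - K p * J p) (fun p => -K p)]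
    simp_rw [neg_sq]
  have he2 : ∀ p, MemLp (e p) 2 Q := fun p => by
    have : e p = fun w => (1 - K p * J p) * innovation V C a (w.2.1, w.2.2.1) p +
      -K p * channelNoise B (diagonal J * V * C) w p := funext (he p)
    rw [this]
    exact (((h.memLp_innovation p).comp_measurePreserving hp).const_mul _).add
      ((hQ.memLp_noise p).const_mul _)
  have hr2 : ∀ i, MemLp (r i) 2 Q := fun i => (h.memLp_residual i).comp_measurePreserving hp
  have hrr : ∀ i j, ∫ w, r i w * r j w ∂Q = covXgivenYZ μ i j := by
    intro i j
    rw [← h.integral_residual_mul i j, ← hQ.law, integral_map (by fun_prop) (by fun_prop)]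
  have hd2 : ∀ i, MemLp (fun w => ∑ p, W i p * e p w) 2 Q := fun i =>
    memLp_finsetSum _ fun p _ => (he2 p).const_mul _
  have hrd : ∀ i j, ∫ w, r i w * (∑ p, W j p * e p w) ∂Q = 0 := by
    intro i j
    have h1 := hch.indepFun (measurable_residual C G c) h.residual_indep
    have hm1 : ∀ p, Measurable fun q : Vec ny × Vec nz × Vec nx =>
        innovation V C a (q.1, q.2.1) p := fun p =>
      (measurable_pi_apply p).comp (hinn.comp (by fun_prop))
    have hm2 : ∀ p, Measurable fun q : Vec ny × Vec nz × Vec nx =>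
        statistic B J a (q.2.1, q.2.2) p := fun p =>
      (measurable_pi_apply p).comp (hst.comp (by fun_prop))
    have hm : Measurable fun q : Vec ny × Vec nz × Vec nx => ∑ p, W j p *
        (innovation V C a (q.1, q.2.1) p - K p * statistic B J a (q.2.1, q.2.2) p) :=
      Finset.measurable_sum _ fun p _ => ((hm1 p).sub ((hm2 p).const_mul _)).const_mul _
    have h2 : IndepFun (r i) (fun w => ∑ p, W j p * e p w) Q :=
      h1.comp (measurable_pi_apply i) hm
    rw [h2.integral_fun_mul_eq_mul_integral (hr2 i).aestronglyMeasurable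
      (hd2 j).aestronglyMeasurable]
    have : ∫ w, r i w ∂Q = 0 := by
      rw [← h.integral_residual i, ← hQ.law, integral_map (by fun_prop) (by fun_prop)]
    rw [this, zero_mul]
  have hexp : ∀ w, (r i w + ∑ p, W i p * e p w) * (r j w + ∑ p, W j p * e p w) =
      (r i w * r j w + (∑ p, W i p * e p w) * (∑ p, W j p * e p w)) +
        (r i w * (∑ p, W j p * e p w) + r j w * (∑ p, W i p * e p w)) := fun w => by ring
  change ∫ w, (r i w + ∑ p, W i p * e p w) * (r j w + ∑ p, W j p * e p w) ∂Q = _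
  simp_rw [hexp]
  have i1 := integrable_fun_mul (hr2 i) (hr2 j)
  have i2 := integrable_fun_mul (hd2 i) (hd2 j)
  have i3 := integrable_fun_mul (hr2 i) (hd2 j)
  have i4 := integrable_fun_mul (hr2 j) (hd2 i)
  rw [integral_add (i1.fun_add i2) (i3.fun_add i4), integral_add i1 i2, integral_add i3 i4,
    hrd, hrd, hrr, integral_sum_mul_sum he2 he2, Matrix.add_apply, mul_mul_transpose_apply]
  simp_rw [hee]
  ring

lemma distortion_le {D : Matrix (Fin nx) (Fin nx) ℝ} {l' : Fin nx → ℝ}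
    (h : IsInnovationForm μ C G c V l a) (hQ : IsAdditiveNoise μ C V B J N Q)
    {W : Matrix (Fin nx) (Fin nx) ℝ} (hW : W * V = 1)
    (hV : V * (D - covXgivenYZ μ) * Vᵀ = diagonal l') (K : Fin nx → ℝ)
    (hK : ∀ i, (1 - K i * J i) ^ 2 * l i + K i ^ 2 * N i ≤ l' i) :
    (D - distortion Q).PosSemidef := by
  have hp := hQ.measurePreserving
  have ha := h.measurable_offset
  have hinn := measurable_innovation V C ha
  have hst := measurable_statistic B J ha
  -- The linear decoder `G z + c + W (a(z) + K s)` with `s` the statistic: `W a(z) + W K s` stands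
  -- in for `C y = W V C y`.
  let f : Fin nx → Vec nx × Vec nz → ℝ := fun i q => (G *ᵥ q.2.ofLp + c.ofLp) i +
    ∑ p, W i p * (a q.2 p + K p * statistic B J a (q.2, q.1) p)
  let err : Fin nx → Joint nx ny nz nx → ℝ := fun i w =>
    residual C G c (w.1, w.2.1, w.2.2.1) i + ∑ p, W i p *
      (innovation V C a (w.2.1, w.2.2.1) p - K p * statistic B J a (w.2.2.1, w.2.2.2) p)
  have hf : ∀ i, Measurable (f i) := fun i => by
    have h1 : ∀ p, Measurable fun q : Vec nx × Vec nz => a q.2 p := fun p => by fun_prop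
    have h2 : ∀ p, Measurable fun q : Vec nx × Vec nz => statistic B J a (q.2, q.1) p := fun p =>
      (measurable_pi_apply p).comp (hst.comp measurable_swap)
    have h3 : Measurable fun q : Vec nx × Vec nz => (G *ᵥ q.2.ofLp + c.ofLp) i := by fun_prop
    exact h3.add (Finset.measurable_sum _ fun p _ =>
      ((h1 p).add ((h2 p).const_mul _)).const_mul _)
  have hWV : ∀ (y : Fin nx → ℝ) i, ∑ p, W i p * (V *ᵥ y) p = y i := fun y i => by
    have : (W *ᵥ (V *ᵥ y)) i = y i := by rw [Matrix.mulVec_mulVec, hW, Matrix.one_mulVec]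
    exact this
  have hfe : ∀ i (w : Joint nx ny nz nx), w.1 i - f i (w.2.2.2, w.2.2.1) = err i w := by
    intro i w
    have h1 := hWV (C *ᵥ w.2.1.ofLp) i
    simp only [f, err, residual, estimate, innovation, Pi.sub_apply, Pi.add_apply]
    have h2 : ∀ t : Fin nx → ℝ, ∑ p, W i p * ((V *ᵥ C *ᵥ w.2.1.ofLp) p - a w.2.2.1 p - t p) =
        (C *ᵥ w.2.1.ofLp) i - ∑ p, W i p * (a w.2.2.1 p + t p) := fun t => by
      rw [← h1, ← Finset.sum_sub_distrib]
      exact Finset.sum_congr rfl fun p _ => by ring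
    rw [h2 fun p => K p * statistic B J a (w.2.2.1, w.2.2.2) p]
    ring
  have hx2 : ∀ j, MemLp (fun w : Joint nx ny nz nx => w.1 j) 2 Q :=
    fun j => (h.memLp_coord j).comp_measurePreserving hp
  have hst2 : ∀ p, MemLp (fun w : Joint nx ny nz nx => statistic B J a (w.2.2.1, w.2.2.2) p) 2 Q :=
    fun p => by
      simp_rw [statistic_eq (V := V) (C := C)]
      exact (((h.memLp_innovation p).comp_measurePreserving hp).const_mul _).add (hQ.memLp_noise p)
  have herr2 : ∀ i, MemLp (err i) 2 Q := fun i =>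
    ((h.memLp_residual i).comp_measurePreserving hp).add (memLp_finsetSum _ fun p _ =>
      (((h.memLp_innovation p).comp_measurePreserving hp).sub ((hst2 p).const_mul _)).const_mul _)
  have hf2 : ∀ i, MemLp (fun w : Joint nx ny nz nx => f i (w.2.2.2, w.2.2.1)) 2 Q := fun i => by
    have : (fun w : Joint nx ny nz nx => f i (w.2.2.2, w.2.2.1)) = fun w => w.1 i - err i w := by
      ext w
      rw [← hfe]
      ring
    rw [this]
    exact (hx2 i).sub (herr2 i)
  have hT : Measurable fun w : Joint nx ny nz nx => (w.2.2.2, w.2.2.1) := by fun_prop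
  have hopt := posSemidef_sub_errorCov (x := fun w : Joint nx ny nz nx => w.1) hT.comap_le hx2 hf2
    fun i => ((hf i).comp (comap_measurable _)).stronglyMeasurable
  have hmat : (Matrix.of fun i j => ∫ w : Joint nx ny nz nx,
      (w.1 i - f i (w.2.2.2, w.2.2.1)) * (w.1 j - f j (w.2.2.2, w.2.2.1)) ∂Q) =
      covXgivenYZ μ +
        W * diagonal (fun i => (1 - K i * J i) ^ 2 * l i + K i ^ 2 * N i) * Wᵀ := by
    ext i j
    rw [Matrix.of_apply, ← hQ.integral_error_mul_error h W K i j]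
    simp_rw [hfe]
    rfl
  have hD : D - covXgivenYZ μ = W * diagonal l' * Wᵀ := by
    have hW2 : Vᵀ * Wᵀ = 1 := by rw [← Matrix.transpose_mul, hW, Matrix.transpose_one]
    rw [← hV]
    calc _ = (W * V) * (D - covXgivenYZ μ) * (Vᵀ * Wᵀ) := by
          rw [hW, hW2, Matrix.one_mul, Matrix.mul_one]
      _ = _ := by simp only [Matrix.mul_assoc]
  have hdiag : (diagonal fun i => l' i -
      ((1 - K i * J i) ^ 2 * l i + K i ^ 2 * N i)).PosSemidef :=
    posSemidef_diagonal_iff.2 fun i => sub_nonneg.2 (hK i)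
  have h3 := hdiag.mul_mul_conjTranspose_same W
  rw [conjTranspose_eq_transpose_of_trivial, ← diagonal_sub, Matrix.mul_sub, Matrix.sub_mul,
    ← hD] at h3
  rw [hmat] at hopt
  -- Two positive semidefinite gaps add up: from `D` down to the error covariance of the linear
  -- decoder, and from there to that of the conditional mean.
  convert h3.add hopt using 1
  rw [← distortion]
  abel

end IsAdditiveNoise

end

section

/-! ### Direct part: the rate of the test channel -/

lemma integrable_gaussianLogRatio_and_integral_eq {Ω : Type*} [MeasurableSpace Ω] {P : Measure Ω}
    [IsProbabilityMeasure P] {v v' : ℝ} (hv : v ≠ 0) (hv' : v' ≠ 0) {b t : Ω → ℝ}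
    (ht : MemLp t 2 P) (hbt : MemLp (fun ω => t ω - b ω) 2 P) (htv : ∫ ω, t ω ^ 2 ∂P = v)
    (hbtv : ∫ ω, (t ω - b ω) ^ 2 ∂P = v') :
    Integrable (fun ω => gaussianLogRatio v v' (b ω) (t ω)) P ∧
      ∫ ω, gaussianLogRatio v v' (b ω) (t ω) ∂P = 1 / 2 * Real.log (v / v') := by
  unfold gaussianLogRatio
  have j1 := (hbt.integrable_sq).div_const (2 * v')
  have j2 := (ht.integrable_sq).div_const (2 * v)
  have j0 : Integrable (fun _ : Ω => 1 / 2 * Real.log (v / v')) P := integrable_const _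
  have j3 : Integrable
      (fun ω => 1 / 2 * Real.log (v / v') - (t ω - b ω) ^ 2 / (2 * v')) P := j0.sub j1
  refine ⟨j3.add j2, ?_⟩
  rw [integral_add j3 j2, integral_sub j0 j1, integral_div, integral_div, htv, hbtv]
  have h1 : v / (2 * v) = 1 / 2 := by field_simp
  have h2 : v' / (2 * v') = 1 / 2 := by field_simp
  rw [h1, h2]
  simp

variable {nx ny nz : ℕ} {μ : Measure (Src nx ny nz)} [IsProbabilityMeasure μ]
  {C : Matrix (Fin nx) (Fin ny) ℝ} {G : Matrix (Fin nx) (Fin nz) ℝ} {c : Vec nx}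
  {V : Matrix (Fin nx) (Fin nx) ℝ} {l : Fin nx → ℝ} {a : Vec nz → Fin nx → ℝ}
  {Q : Measure (Joint nx ny nz nx)}
  {B : Matrix (Fin nx) (Fin nx) ℝ} {J N : Fin nx → ℝ}

namespace IsAdditiveNoise

lemma map_statistic (h : IsInnovationForm μ C G c V l a) (hQ : IsAdditiveNoise μ C V B J N Q) :
    Q.map (fun w => (w.2.2.1, statistic B J a (w.2.2.1, w.2.2.2))) =
      (Q.map fun w => w.2.2.1).prod
        (Measure.pi fun i => gaussianReal 0 (J i ^ 2 * l i + N i).toNNReal) := by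
  have hinn := h.measurePreserving_innovation.measurable
  have hinni : ∀ i, Measurable fun s : Src nx ny nz => innovation V C a s.2 i := fun i =>
    (measurable_pi_apply i).comp hinn
  have hZ : Q.map (fun w => w.2.2.1) = μ.map fun s => s.2.2 := by
    rw [← hQ.law, Measure.map_map (by fun_prop) (by fun_prop)]
    rfl
  have hf : Measurable fun p : Src nx ny nz × (Fin nx → ℝ) =>
      (p.1.2.2, fun i => J i * innovation V C a p.1.2 i + p.2 i) := by
    refine Measurable.prodMk (by fun_prop) (measurable_pi_lambda _ fun i => ?_)
    exact (((hinni i).comp measurable_fst).const_mul _).add (by fun_prop)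
  rw [hZ, ← map_add_noise_eq_prod (ζ := fun s : Src nx ny nz => s.2.2) (by fun_prop) hinn h.nonneg
    (fun i => (hQ.pos i).le) J h.map_prodMk_innovation, ← hQ.map_noise,
    Measure.map_map hf (by fun_prop)]
  refine congrArg (fun f => Q.map f) (funext fun w => Prod.ext rfl (funext fun i => ?_))
  exact statistic_eq w i

lemma map_statistic_withDensity (h : IsInnovationForm μ C G c V l a)
    (hQ : IsAdditiveNoise μ C V B J N Q) {N' : Fin nx → ℝ} (hN' : ∀ i, 0 < N' i) :
    Q.map (fun w => ((w.2.2.1, w.2.1), statistic B J a (w.2.2.1, w.2.2.2))) =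
      ((Q.map fun w => (w.2.2.1, w.2.1)).prod
        (Measure.pi fun i => gaussianReal 0 (N' i).toNNReal)).withDensity fun p =>
          ENNReal.ofReal (Real.exp (∑ i, gaussianLogRatio (N' i) (N i)
            (J i * innovation V C a (p.1.2, p.1.1) i) (p.2 i))) := by
  have hinn := measurable_innovation V C h.measurable_offset
  have hb : Measurable fun (q : Vec nz × Vec ny) i => J i * innovation V C a (q.2, q.1) i :=
    measurable_pi_lambda _ fun i =>
      ((measurable_pi_apply i).comp (hinn.comp measurable_swap)).const_mul _
  have hZ : Q.map (fun w => (w.2.2.1, w.2.1)) = μ.map fun s => (s.2.2, s.2.1) := by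
    rw [← hQ.law, Measure.map_map (by fun_prop) (by fun_prop)]
    rfl
  have hbi : ∀ i, Measurable fun p : Src nx ny nz × (Fin nx → ℝ) =>
      J i * innovation V C a (p.1.2.1, p.1.2.2) i := fun i =>
    ((measurable_pi_apply i).comp (hinn.comp (by fun_prop))).const_mul _
  have hf : Measurable fun p : Src nx ny nz × (Fin nx → ℝ) =>
      ((p.1.2.2, p.1.2.1), fun i => J i * innovation V C a (p.1.2.1, p.1.2.2) i + p.2 i) :=
    Measurable.prodMk (by fun_prop) (measurable_pi_lambda _ fun i => (hbi i).add (by fun_prop))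
  rw [hZ, ← map_add_noise_eq_withDensity (q := fun s : Src nx ny nz => (s.2.2, s.2.1))
    (by fun_prop) hb hQ.pos hN', ← hQ.map_noise, Measure.map_map hf (by fun_prop)]
  refine congrArg (fun f => Q.map f) (funext fun w => Prod.ext rfl (funext fun i => ?_))
  exact statistic_eq w i

/-- Given `z`, the statistic has independent coordinates `N(0, J² l + N)`; given also `y`, they are
`N(J w, N)`. In the mean of the log-ratio the quadratic terms contribute `-1/2` and `1/2` and
cancel. -/
lemma rate_le [IsProbabilityMeasure Q] (h : IsInnovationForm μ C G c V l a) (hQ : IsAdditiveNoise μ C V B J N Q)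
    {M : Matrix (Fin nx) (Fin nx) ℝ} (hM : M * B = 1) :
    rate Q ≤ ENNReal.ofReal (∑ i, 1 / 2 * Real.log ((J i ^ 2 * l i + N i) / N i)) := by
  have hp := hQ.measurePreserving
  have ha := h.measurable_offset
  have hinn := measurable_innovation V C ha
  have hst := measurable_statistic B J ha
  have hN' : ∀ i, 0 < J i ^ 2 * l i + N i := fun i =>
    add_pos_of_nonneg_of_pos (mul_nonneg (sq_nonneg _) (h.nonneg i)) (hQ.pos i)
  have hψ : Measurable fun p : Vec nz × (Fin nx → ℝ) =>
      (WithLp.toLp 2 (M *ᵥ (p.2 + diagonal J *ᵥ a p.1)) : Vec nx) := by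
    have h1 : Measurable fun p : Vec nz × (Fin nx → ℝ) => p.2 + diagonal J *ᵥ a p.1 :=
      measurable_snd.add ((measurable_mulVec (diagonal J)).comp (ha.comp measurable_fst))
    have h2 := (measurable_mulVec M).comp h1
    exact (WithLp.measurable_toLp 2 _).comp h2
  have hψφ : ∀ (z : Vec nz) (u : Vec nx),
      (WithLp.toLp 2 (M *ᵥ (statistic B J a (z, u) + diagonal J *ᵥ a z)) : Vec nx) = u := by
    intro z u
    simp [statistic, Matrix.mulVec_mulVec, hM]
  have hw2 := fun i => (h.memLp_innovation i).comp_measurePreserving hp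
  have hn : ∀ i (w : Joint nx ny nz nx), statistic B J a (w.2.2.1, w.2.2.2) i -
      J i * innovation V C a (w.2.1, w.2.2.1) i = channelNoise B (diagonal J * V * C) w i :=
    fun i w => by rw [statistic_eq (V := V) (C := C), add_sub_cancel_left]
  have hterm : ∀ i, _ ∧ _ := fun i => integrable_gaussianLogRatio_and_integral_eq
    (P := Q) (v := J i ^ 2 * l i + N i) (v' := N i)
    (b := fun w => J i * innovation V C a (w.2.1, w.2.2.1) i)
    (t := fun w => statistic B J a (w.2.2.1, w.2.2.2) i) (hN' i).ne' (hQ.pos i).ne'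
    (by
      simp_rw [statistic_eq (V := V) (C := C)]
      exact ((hw2 i).const_mul _).add (hQ.memLp_noise i))
    (by
      simp_rw [hn]
      exact hQ.memLp_noise i)
    (by
      have := hQ.integral_comb_mul_comb h J (fun _ => 1) i i
      rw [diagonal_apply_eq] at this
      simp_rw [statistic_eq (V := V) (C := C)]
      simpa [sq] using this)
    (by
      have := hQ.integral_noise_mul i i
      rw [diagonal_apply_eq] at this
      simp_rw [hn, sq]
      exact this)
  have hinni : ∀ i, Measurable fun p : (Vec nz × Vec ny) × (Fin nx → ℝ) =>
      (J i * innovation V C a (p.1.2, p.1.1) i, p.2 i) := fun i =>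
    (((measurable_pi_apply i).comp (hinn.comp (by fun_prop))).const_mul _).prodMk (by fun_prop)
  have key := condMutualInfo_le_of_withDensity_exp (P := Q) (Y := fun w => w.2.1)
    (U := fun w => w.2.2.2) (Z := fun w => w.2.2.1) (by fun_prop) (by fun_prop) (by fun_prop) hst hψ
    hψφ (hQ.map_statistic h) (g := fun p => ∑ i, gaussianLogRatio (J i ^ 2 * l i + N i) (N i)
      (J i * innovation V C a (p.1.2, p.1.1) i) (p.2 i))
    (Finset.measurable_sum _ fun i _ => (measurable_gaussianLogRatio _ _).comp (hinni i))
    (hQ.map_statistic_withDensity h hN')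
    (integrable_finsetSum _ fun i _ => (hterm i).1)
  refine key.trans (ENNReal.ofReal_le_ofReal (le_of_eq ?_))
  refine (integral_finsetSum _ fun i _ => (hterm i).1).trans ?_
  exact Finset.sum_congr rfl fun i _ => (hterm i).2

end IsAdditiveNoise

/-- Reverse water-filling: a Gaussian test channel with the noise variances
`l l' / (l - l')` on the active coordinates is optimal. -/
lemma isAdmissible_and_rate_eq_logSum {D : Matrix (Fin nx) (Fin nx) ℝ} {l' : Fin nx → ℝ}
    (h : IsInnovationForm μ C G c V l a) (hV : IsUnit V) (hl' : ∀ i, 0 < l' i)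
    (hD : V * (D - covXgivenYZ μ) * Vᵀ = diagonal l')
    {T : Matrix (Fin nx) (Fin ny) ℝ} {S M : Matrix (Fin nx) (Fin nx) ℝ} (hS : S.PosSemidef)
    (hB : B * S * Bᵀ = diagonal N) (hM : M * B = 1) (hN : ∀ i, 0 < N i)
    (hJ : ∀ i, J i = if l' i < l i then 1 else 0)
    (hNI : ∀ i, l' i < l i → N i = l i * l' i / (l i - l' i))
    (hT : B * T = diagonal J * V * C) :
    IsAdmissible μ D (gaussianTestChannel μ T S) ∧
      rate (gaussianTestChannel μ T S) = ENNReal.ofReal (logSum l l') := by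
  have hQ := isAdditiveNoise_gaussianTestChannel (μ := μ) hS hB hT hN
  obtain ⟨κ, hκ, hch⟩ := hQ.exists_channel
  have hW : V⁻¹ * V = 1 := Matrix.nonsing_inv_mul _ ((Matrix.isUnit_iff_isUnit_det _).1 hV)
  -- The gain `(l - l')/l` is the Wiener gain `l/(l + N)` for `N = l l'/(l - l')`, and the resulting
  -- error is exactly `l'`. On inactive coordinates nothing is decoded, and the error `l` is within
  -- the budget.
  have hdist := hQ.distortion_le h hW hD (fun i => if l' i < l i then (l i - l' i) / l i else 0)
    fun i => by
      rw [hJ]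
      by_cases hi : l' i < l i
      · rw [if_pos hi, if_pos hi, hNI i hi]
        have h1 : l i ≠ 0 := ((hl' i).trans hi).ne'
        have h2 : l i - l' i ≠ 0 := (sub_pos.2 hi).ne'
        refine le_of_eq ?_
        field_simp
        ring
      · rw [if_neg hi, if_neg hi]
        linarith
  have hadm : IsAdmissible μ D (gaussianTestChannel μ T S) := ⟨hQ.law, hch.condIndepFun, hdist⟩
  refine ⟨hadm, le_antisymm ?_ (h.le_rate hl' hD hadm)⟩
  -- On active coordinates `(l + N)/N = l/l'`; on inactive ones `J = 0` and the logarithm vanishes.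
  refine (hQ.rate_le h hM).trans (ENNReal.ofReal_le_ofReal (le_of_eq ?_))
  rw [logSum_eq_sum_ite _ _ hl']
  refine Finset.sum_congr rfl fun i _ => ?_
  rw [hJ]
  by_cases hi : l' i < l i
  · rw [if_pos hi, if_pos hi]
    congr 2
    rw [hNI i hi]
    have h1 : l i ≠ 0 := ((hl' i).trans hi).ne'
    have h2 : l i - l' i ≠ 0 := (sub_pos.2 hi).ne'
    have h3 := (hl' i).ne'
    field_simp
    ring
  · rw [if_neg hi, if_neg hi]
    simp [div_self (hN i).ne']

end

section

/-! ### Optimal test channels and assembly -/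

lemma IsJointDiagonalization.pos {n : ℕ} {Sig1 Sig2 U V : Matrix (Fin n) (Fin n) ℝ}
    {l l' : Fin n → ℝ} (h : IsJointDiagonalization Sig1 Sig2 U V l l') (h2 : Sig2.PosDef)
    (i : Fin n) : 0 < l' i := by
  have h3 := h2.mul_mul_conjTranspose_same (Matrix.vecMul_injective_of_isUnit h.nonsingular)
  rw [conjTranspose_eq_transpose_of_trivial, h.diag_right] at h3
  exact posDef_diagonal_iff.1 h3 i

/-- The noise variances of the optimal test channel. -/
noncomputable def channelVariance {n : ℕ} (l l' : Fin n → ℝ) (i : Fin n) : ℝ :=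
  -- Inactive coordinates carry pure noise. Any positive variance would do; it keeps the noise
  -- covariance nonsingular.
  if l' i < l i then l i * l' i / (l i - l' i) else 1

lemma channelVariance_pos {n : ℕ} {l l' : Fin n → ℝ} (hl' : ∀ i, 0 < l' i) (i : Fin n) :
    0 < channelVariance l l' i := by
  unfold channelVariance
  split_ifs with hi
  · exact div_pos (mul_pos ((hl' i).trans hi) (hl' i)) (sub_pos.2 hi)
  · exact one_pos

variable {nx ny nz : ℕ} {μ : Measure (Src nx ny nz)} [IsGaussian μ]
  {D U V : Matrix (Fin nx) (Fin nx) ℝ} {l l' : Fin nx → ℝ}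
  {C : Matrix (Fin nx) (Fin ny) ℝ} {G : Matrix (Fin nx) (Fin nz) ℝ}

/-- An optimal test channel with independent noise coordinates. -/
lemma exists_optimal_testChannel (hD : (D - covXgivenYZ μ).PosDef)
    (hdiag : IsJointDiagonalization (covXgivenZ μ - covXgivenYZ μ) (D - covXgivenYZ μ) U V l l')
    (hCG : IsEstimator μ C G) :
    ∃ W S : Matrix (Fin nx) (Fin nx) ℝ, S.PosDef ∧
      IsAdmissible μ D (gaussianTestChannel μ (W * (U * C)) S) ∧
      rate (gaussianTestChannel μ (W * (U * C)) S) = ENNReal.ofReal (logSum l l') := by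
  obtain ⟨c, a, h⟩ := hCG.exists_isInnovationForm hdiag.diag_left
  have hl' := hdiag.pos hD
  have hN := channelVariance_pos (l := l) hl'
  have hS : (diagonal (channelVariance l l')).PosDef := posDef_diagonal_iff.2 hN
  have hU : Uᵀ * U = 1 := mul_eq_one_comm.1 hdiag.orthogonal
  -- The factor `Uᵀ` undoes `U`, so that `W U C` is `V C` with its inactive rows set to zero.
  refine ⟨diagonal (fun i => if l' i < l i then 1 else 0) * V * Uᵀ,
    diagonal (channelVariance l l'), hS, ?_⟩
  refine isAdmissible_and_rate_eq_logSum (B := 1) (M := 1) h hdiag.nonsingular hl'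
    hdiag.diag_right hS.posSemidef (by simp) (Matrix.one_mul 1) hN (fun i => rfl)
    (fun i hi => if_pos hi) ?_
  rw [Matrix.one_mul, Matrix.mul_assoc _ Uᵀ, ← Matrix.mul_assoc Uᵀ, hU, Matrix.one_mul]

/-- If all coordinates are active, the source can be sent with additive noise. -/
lemma isAdmissible_and_rate_eq_logSum_of_lt (hD : (D - covXgivenYZ μ).PosDef)
    (hdiag : IsJointDiagonalization (covXgivenZ μ - covXgivenYZ μ) (D - covXgivenYZ μ) U V l l')
    (hCG : IsEstimator μ C G) (hlt : ∀ i, l' i < l i) {S : Matrix (Fin nx) (Fin nx) ℝ}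
    (hS : S = U * V⁻¹ * diagonal (fun i => l i * l' i / (l i - l' i)) * (V⁻¹)ᵀ * Uᵀ) :
    IsAdmissible μ D (gaussianTestChannel μ (U * C) S) ∧
      rate (gaussianTestChannel μ (U * C) S) = ENNReal.ofReal (logSum l l') := by
  obtain ⟨c, a, h⟩ := hCG.exists_isInnovationForm hdiag.diag_left
  have hl' := hdiag.pos hD
  have hN : ∀ i, 0 < l i * l' i / (l i - l' i) := fun i =>
    div_pos (mul_pos ((hl' i).trans (hlt i)) (hl' i)) (sub_pos.2 (hlt i))
  have hU : Uᵀ * U = 1 := mul_eq_one_comm.1 hdiag.orthogonal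
  have hV := (Matrix.isUnit_iff_isUnit_det _).1 hdiag.nonsingular
  -- Applying `V Uᵀ` to `u = U C y + ν` gives `V C y` plus noise, and the prescribed covariance of
  -- `ν` makes this noise diagonal.
  have hBM : (V * Uᵀ) * (U * V⁻¹) = 1 := by
    rw [Matrix.mul_assoc, ← Matrix.mul_assoc Uᵀ, hU, Matrix.one_mul, Matrix.mul_nonsing_inv _ hV]
  have hS' : S = (U * V⁻¹) * diagonal (fun i => l i * l' i / (l i - l' i)) * (U * V⁻¹)ᵀ := by
    rw [hS, Matrix.transpose_mul]
    simp only [Matrix.mul_assoc]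
  have hpos : S.PosSemidef := by
    have := (posSemidef_diagonal_iff.2 fun i => (hN i).le).mul_mul_conjTranspose_same (U * V⁻¹)
    rwa [conjTranspose_eq_transpose_of_trivial, ← hS'] at this
  refine isAdmissible_and_rate_eq_logSum (B := V * Uᵀ) (M := U * V⁻¹) h hdiag.nonsingular hl'
    hdiag.diag_right hpos ?_ (mul_eq_one_comm.1 hBM) hN (fun i => rfl) (fun i _ => rfl) ?_
  · calc V * Uᵀ * S * (V * Uᵀ)ᵀ = ((V * Uᵀ) * (U * V⁻¹)) *
          diagonal (fun i => l i * l' i / (l i - l' i)) * ((V * Uᵀ) * (U * V⁻¹))ᵀ := by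
          rw [hS', Matrix.transpose_mul (V * Uᵀ) (U * V⁻¹)]
          simp only [Matrix.mul_assoc]
      _ = _ := by simp [hBM]
  · have hJ : (diagonal fun i => if l' i < l i then (1 : ℝ) else 0) = 1 := by
      simp [hlt]
    rw [hJ, Matrix.one_mul, Matrix.mul_assoc, ← Matrix.mul_assoc Uᵀ, hU, Matrix.one_mul]

end

end RemoteSource

theorem theorem3 {nx ny nz : ℕ}
    (μ : Measure (Vec nx × Vec ny × Vec nz)) [IsGaussian μ]
    (D U V : Matrix (Fin nx) (Fin nx) ℝ) (l l' : Fin nx → ℝ)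
    (hD : (D - covXgivenYZ μ).PosDef)
    (hdiag : IsJointDiagonalization (covXgivenZ μ - covXgivenYZ μ) (D - covXgivenYZ μ) U V l l') :
    (ENNReal.ofReal (logSum (sorted l) (sorted l')) ≤ rdf μ D ∧
      rdf μ D ≤ ENNReal.ofReal (logSum l l')) ∧
    (∀ (C : Matrix (Fin nx) (Fin ny) ℝ) (G : Matrix (Fin nx) (Fin nz) ℝ), IsEstimator μ C G →
      (∃ (k : ℕ) (W : Matrix (Fin k) (Fin nx) ℝ) (S : Matrix (Fin k) (Fin k) ℝ), S.PosDef ∧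
        IsAdmissible μ D (gaussianTestChannel μ (W * (U * C)) S) ∧
        rate (gaussianTestChannel μ (W * (U * C)) S) = ENNReal.ofReal (logSum l l')) ∧
      ((∀ i, l' i < l i) →
        ∀ S : Matrix (Fin nx) (Fin nx) ℝ,
          S = U * V⁻¹ * diagonal (fun i => l i * l' i / (l i - l' i)) * (V⁻¹)ᵀ * Uᵀ →
          IsAdmissible μ D (gaussianTestChannel μ (U * C) S) ∧
          rate (gaussianTestChannel μ (U * C) S) = ENNReal.ofReal (logSum l l'))) := by
  have hl' := hdiag.pos hD
  obtain ⟨C₀, G₀, hCG₀⟩ := exists_isEstimator μ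
  refine ⟨⟨?_, ?_⟩, fun C G hCG => ⟨?_, fun hlt S hS => ?_⟩⟩
  · obtain ⟨c, a, h⟩ := hCG₀.exists_isInnovationForm hdiag.diag_left
    refine le_iInf fun k => le_iInf fun Q => le_iInf fun hQ => le_iInf fun hadm => ?_
    -- The sorted bound is reached through the stronger unsorted one, which bounds every admissible
    -- rate.
    exact (ENNReal.ofReal_le_ofReal (logSum_sorted_le l l' hl')).trans
      (h.le_rate hl' hdiag.diag_right hadm)
  · obtain ⟨W, S, -, hadm, hrate⟩ := exists_optimal_testChannel hD hdiag hCG₀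
    rw [← hrate]
    exact iInf_le_of_le nx (iInf_le_of_le _ (iInf_le_of_le inferInstance (iInf_le _ hadm)))
  · obtain ⟨W, S, hS, hadm, hrate⟩ := exists_optimal_testChannel hD hdiag hCG
    exact ⟨nx, W, S, hS, hadm, hrate⟩
  · exact isAdmissible_and_rate_eq_logSum_of_lt hD hdiag hCG hlt hS
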